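/- **Setting.** Let $f_0$ be a probability density on $\mathbb{R}$ (with respect to a $\sigma$-finite measure) and let $f_\theta(x)=\exp(\theta x-b(\theta))f_0(x)$, $\theta\in\Theta=[\theta_\ell,\theta_u]$, $0<\theta_\ell<\theta_u$, $b(0)=0$, be probability densities, such that for every $\theta\in\Theta$ the divergences $D(f_\theta\|f_0)=\mathbb{E}_{f_\theta}[\log\frac{f_\theta}{f_0}(X)]$ and $D(f_0\|f_\theta)=-\mathbb{E}_{f_0}[\log\frac{f_\theta}{f_0}(X)]$ are finite and positive. Assume that $\theta^*\in\Theta$ is least favorable: $\mathbb{E}_{f_\theta}[\log\frac{f_{\theta^*}}{f_0}(X)]>0$ for all $\theta\in\Theta$. The observations $X_1,X_2,\dots$ are independent; under $\mathbb{P}_\infty$ all have density $f_0$, and under $\mathbb{P}^\theta_\gamma$ ($\gamma\ge1$) $X_n$ has density $f_0$ for $n<\gamma$ and $f_\theta$ for $n\ge\gamma$. A policy consists of indicators $S_n\in\{0,1\}$ ($S_n=1$ if $X_n$ is used) and a stopping time $\tau$; $\mathcal{I}_n$ is the information in $S_1,\dots,S_n$ and those $X_k$, $k\le n$, with $S_k=1$.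 Put $\mathsf{FAR}=1/\mathbb{E}_\infty[\tau]$, $\mathsf{PDC}=\limsup_{\gamma\to\infty}\mathbb{E}_\infty[\frac1\gamma\sum_{n=1}^{\gamma-1}S_n]$ and $\mathsf{WADD}^\theta=\sup_{\gamma\ge1}\operatorname{ess\,sup}\mathbb{E}^\theta_\gamma[(\tau-\gamma)^+\mid\mathcal{I}_{\gamma-1}]$. Let $L_\theta=\log(f_\theta/f_0)$, $A\in\mathbb{R}$, $\mu>0$, $h\in[0,\infty]$. * GCuSum: $S_n=1$ for all $n$ and $\tau_{GC}=\inf\{n\ge1:\max_{1\le k\le n}\sup_{\theta\in\Theta}\sum_{i=k}^nL_\theta(X_i)\ge A\}$. * DECuSum for $f_{\theta^*}$: $W_0=0$; if $W_{n-1}\ge0$ then $S_n=1$ and $W_n=\max\{W_{n-1}+L_{\theta^*}(X_n),-h\}$; if $W_{n-1}<0$ then $S_n=0$ and $W_n=\min\{W_{n-1}+\mu,0\}$; $\tau_W(\theta^*)=\inf\{n\ge1:W_n\ge A\}$. * GDECuSum: $W_0=0$; if $W_{n-1}\ge0$ then $S_n=1$ and $W_n=\max\{-h,\max_{1\le k\le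 n}\sum_{i=k}^nS_iL_{\theta^*}(X_i)\}$; if $W_{n-1}<0$ then $S_n=0$ and $W_n=\min\{0,W_{n-1}+\mu\}$; $\tau_{GD}=\inf\{n\ge1:\max_{1\le k\le n}\sup_{\theta\in\Theta}\sum_{i=k}^nS_iL_\theta(X_i)\ge A\}$. **Claim.** Write $u_\alpha\sim v_\alpha$ for $u_\alpha/v_\alpha\to1$ as $\alpha\to0^+$. 1. There are thresholds $A_\alpha\sim\log(1/\alpha)$, not depending on $\mu$ and $h$, such that $\mathsf{FAR}(\tau_{GC})\le\alpha(1+o(1))$ as $\alpha\to0$. 2. For all thresholds $A_\alpha\sim\log(1/\alpha)$, in particular those in 1, for all $\mu>0$ and $h\in[0,\infty]$: $\mathsf{FAR}(\tau_{GD})\le\mathsf{FAR}(\tau_{GC})$ whenever $A_\alpha>0$ (hence for all small $\alpha$), and $\mathsf{PDC}(\tau_{GD})=\mathsf{PDC}(\tau_W(\theta^*))$. If moreover $h<\infty$, then for each $\theta\in[\theta_\ell,\theta_u]$ $$\mathsf{WADD}^\theta(\tau_{GD})\sim\mathsf{WADD}^\theta(\tau_{GC})\sim\frac{|\log\alpha|}{D(f_\theta\|f_0)}\quad\text{as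 }\alpha\to0.$$ Consequently, with $A_\alpha$ as in 1, $\mathsf{FAR}(\tau_{GD})\le\mathsf{FAR}(\tau_{GC})\le\alpha(1+o(1))$ as $\alpha\to0$. -/

import Mathlib

open MeasureTheory Filter Topology
open scoped ENNReal

namespace QCD

noncomputable section

/-! A sample path of the observations is a function `x : ℕ → ℝ`; the observation `X n` is the
coordinate `x n` for `n ≥ 1`, and the coordinate `x 0` is never used. -/

/-- `g` is a probability density with respect to the reference measure `ν`. -/
def IsPDF (ν : Measure ℝ) (g : ℝ → ℝ) : Prop :=
  Measurable g ∧ (∀ x, 0 ≤ g x) ∧ ∫⁻ x, ENNReal.ofReal (g x) ∂ν = 1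

/-- The law of one observation with density `g`. -/
def obsLaw (ν : Measure ℝ) (g : ℝ → ℝ) : Measure ℝ :=
  ν.withDensity (fun x => ENNReal.ofReal (g x))

/-- The law of the whole sequence if no change ever occurs: i.i.d. with density `f₀`. -/
def lawNoChange (ν : Measure ℝ) (f₀ : ℝ → ℝ) : Measure (ℕ → ℝ) :=
  Measure.infinitePi (fun _ : ℕ => obsLaw ν f₀)

/-- The law of the whole sequence if the change point is `γ`: the observations are independent,
`X n` has density `f₀` for `n < γ` and density `g` for `n ≥ γ`. -/
def lawChange (ν : Measure ℝ) (f₀ g : ℝ → ℝ) (γ : ℕ) : Measure (ℕ → ℝ) :=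
  Measure.infinitePi (fun n : ℕ => if n < γ then obsLaw ν f₀ else obsLaw ν g)

/-- The log-likelihood ratio `log (g / f₀)` of one observation. -/
def llr (f₀ g : ℝ → ℝ) (x : ℝ) : ℝ := Real.log (g x / f₀ x)

/-- A control policy: the indicators `S n ∈ {0, 1}`, `n ≥ 1`, of the event that `X n` is used for
decision making, and the stopping time `τ` at which a change is declared. -/
structure Policy where
  /-- the indicator that the `n`-th observation is used -/
  S : ℕ → (ℕ → ℝ) → ℝ
  /-- the stopping time -/
  τ : (ℕ → ℝ) → ℕ∞

/-- The information `I n` available at time `n`: the indicators `S k`, and those `X k` with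
`S k = 1`, for `1 ≤ k ≤ n`. -/
@[reducible] def Policy.info (Ψ : Policy) (n : ℕ) : MeasurableSpace (ℕ → ℝ) :=
  ⨆ k ∈ Finset.Icc 1 n,
    MeasurableSpace.comap (fun x : ℕ → ℝ => (Ψ.S k x, Ψ.S k x * x k)) inferInstance

/-- False alarm rate `1 / E_∞[τ]`. -/
def FAR (ν : Measure ℝ) (f₀ : ℝ → ℝ) (Ψ : Policy) : ℝ≥0∞ :=
  (∫⁻ x, (Ψ.τ x : ℝ≥0∞) ∂(lawNoChange ν f₀))⁻¹

/-- Pre-change duty cycle `limsup_γ E_∞[(1/γ) ∑_{n=1}^{γ-1} S n]`. -/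
def PDC (ν : Measure ℝ) (f₀ : ℝ → ℝ) (Ψ : Policy) : ℝ≥0∞ :=
  limsup (fun γ : ℕ => ∫⁻ x, ENNReal.ofReal ((1 / (γ : ℝ)) * ∑ n ∈ Finset.Ico 1 γ, Ψ.S n x)
    ∂(lawNoChange ν f₀)) atTop

/-- Worst case average detection delay `sup_{γ ≥ 1} ess sup E_γ[(τ - γ)⁺ | I (γ-1)]` when the
post-change density is `g` (subtraction in `[0, ∞]` is truncated at `0`). -/
def WADD (ν : Measure ℝ) (f₀ g : ℝ → ℝ) (Ψ : Policy) : ℝ≥0∞ :=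
  ⨆ (γ : ℕ) (_ : 1 ≤ γ),
    essSup (condLExp (Ψ.info (γ - 1)) (lawChange ν f₀ g γ)
      (fun x => (Ψ.τ x : ℝ≥0∞) - (γ : ℝ≥0∞))) (lawChange ν f₀ g γ)

/-- The first time `n ≥ 1` at which the statistic `G n` is at least `A` (`⊤` if there is none). -/
def firstPassage (G : ℕ → EReal) (A : ℝ) : ℕ∞ :=
  ⨅ (n : ℕ) (_ : 1 ≤ n ∧ (A : EReal) ≤ G n), (n : ℕ∞)

/-- The sum over `k ≤ i ≤ n` of the log-likelihood ratios `L` of the used observations; a skipped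
observation (`s i = 0`) contributes `0`. -/
def usedSum (s : ℕ → ℝ) (L : ℝ → ℝ) (x : ℕ → ℝ) (k n : ℕ) : ℝ :=
  ∑ i ∈ Finset.Icc k n, s i * L (x i)

/-- The generalized likelihood ratio statistic
`max_{1 ≤ k ≤ n} sup_{θ ∈ Θ} ∑_{i=k}^n log (f θ / f₀)` of the used observations. -/
def glrStat (f₀ : ℝ → ℝ) (f : ℝ → ℝ → ℝ) (Θ : Set ℝ) (s : ℕ → ℝ) (x : ℕ → ℝ) (n : ℕ) : EReal :=
  ⨆ k ∈ Finset.Icc 1 n, ⨆ θ ∈ Θ, ((usedSum s (llr f₀ (f θ)) x k n : ℝ) : EReal)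

/-- The GCuSum test with threshold `A`: every observation is used. -/
def gcusum (f₀ : ℝ → ℝ) (f : ℝ → ℝ → ℝ) (Θ : Set ℝ) (A : ℝ) : Policy where
  S := fun _ _ => 1
  τ := fun x => firstPassage (glrStat f₀ f Θ (fun _ => 1) x) A

/-- Truncation `max (x, -h)` from below, with no truncation if `h = ∞`. -/
def truncBelow (h : ℝ≥0∞) (y : ℝ) : ℝ := if h = ∞ then y else max y (-h.toReal)

/-- The DECuSum statistic `W n` for the log-likelihood ratio `L`, started at `0`. -/
def decusumStat (L : ℝ → ℝ) (μ : ℝ) (h : ℝ≥0∞) (x : ℕ → ℝ) : ℕ → ℝ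
  | 0 => 0
  | n + 1 =>
    if 0 ≤ decusumStat L μ h x n then truncBelow h (decusumStat L μ h x n + L (x (n + 1)))
    else min (decusumStat L μ h x n + μ) 0

/-- The DECuSum test for a known post-change density `g`, with threshold `A`: the observation
`X n` is used if and only if `W (n-1) ≥ 0`, and one stops when `W n ≥ A`. -/
def decusum (f₀ g : ℝ → ℝ) (μ : ℝ) (h : ℝ≥0∞) (A : ℝ) : Policy where
  S := fun n x => if 0 ≤ decusumStat (llr f₀ g) μ h x (n - 1) then 1 else 0
  τ := fun x => firstPassage (fun n => ((decusumStat (llr f₀ g) μ h x n : ℝ) : EReal)) A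

/-- The observation control of the GDECuSum test, for the log-likelihood ratio `L` of the least
favorable density. The state at time `n` is the statistic `W n` together with the indicators
`S 1, …, S n` used so far. If `W n ≥ 0` then `S (n+1) = 1` and
`W (n+1) = max (-h, max_{1 ≤ k ≤ n+1} ∑_{i=k}^{n+1} L)`, the sum being over used observations;
if `W n < 0` then `S (n+1) = 0` and `W (n+1) = min (0, W n + μ)`. -/
def gdState (L : ℝ → ℝ) (μ : ℝ) (h : ℝ≥0∞) (x : ℕ → ℝ) : ℕ → ℝ × (ℕ → ℝ)
  | 0 => (0, fun _ => 0)
  | n + 1 =>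
    let w := (gdState L μ h x n).1
    let s := (gdState L μ h x n).2
    if 0 ≤ w then
      (truncBelow h ((Finset.Icc 1 (n + 1)).sup' ⟨1, by simp⟩
          (fun k => usedSum (Function.update s (n + 1) 1) L x k (n + 1))),
        Function.update s (n + 1) 1)
    else (min 0 (w + μ), Function.update s (n + 1) 0)

/-- The indicator that `X n` is used by the GDECuSum test. -/
def gdControl (L : ℝ → ℝ) (μ : ℝ) (h : ℝ≥0∞) (n : ℕ) (x : ℕ → ℝ) : ℝ :=
  (gdState L μ h x n).2 n

/-- The GDECuSum test with threshold `A`: the observations are controlled through the density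
`f θs`, and the change is detected by the generalized likelihood ratio statistic of the used
observations over the whole family. -/
def gdecusum (f₀ : ℝ → ℝ) (f : ℝ → ℝ → ℝ) (Θ : Set ℝ) (θs μ : ℝ) (h : ℝ≥0∞) (A : ℝ) : Policy where
  S := gdControl (llr f₀ (f θs)) μ h
  τ := fun x =>
    firstPassage (glrStat f₀ f Θ (fun i => gdControl (llr f₀ (f θs)) μ h i x) x) A

/-- `D(g ‖ f₀)`, the expectation of `log (g / f₀)` under `g`. -/
def divPost (ν : Measure ℝ) (f₀ g : ℝ → ℝ) : ℝ := ∫ x, llr f₀ g x ∂(obsLaw ν g)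

/-- `D(f₀ ‖ g)`, minus the expectation of `log (g / f₀)` under `f₀`. -/
def divPre (ν : Measure ℝ) (f₀ g : ℝ → ℝ) : ℝ := -∫ x, llr f₀ g x ∂(obsLaw ν f₀)

/-- `D(g ‖ f₀)` and `D(f₀ ‖ g)` are finite and positive. -/
def FinitePosDivergences (ν : Measure ℝ) (f₀ g : ℝ → ℝ) : Prop :=
  Integrable (llr f₀ g) (obsLaw ν g) ∧ 0 < divPost ν f₀ g ∧
  Integrable (llr f₀ g) (obsLaw ν f₀) ∧ 0 < divPre ν f₀ g

/-- `f θs` is least favorable: `log (f θs / f₀)` has positive mean under every `f θ`, `θ ∈ Θ`.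
(A positive Bochner integral forces integrability.) -/
def IsLeastFavorable (ν : Measure ℝ) (f₀ : ℝ → ℝ) (f : ℝ → ℝ → ℝ) (Θ : Set ℝ) (θs : ℝ) : Prop :=
  θs ∈ Θ ∧ ∀ θ ∈ Θ, 0 < ∫ x, llr f₀ (f θs) x ∂(obsLaw ν (f θ))

/-- The thresholds satisfy `A α ~ log (1/α)` as `α → 0`. -/
def IsThreshold (A : ℝ → ℝ) : Prop :=
  Tendsto (fun α : ℝ => A α / Real.log (1 / α)) (𝓝[>] 0) (𝓝 1)

/-- `u α ~ v α` as `α → 0`: the ratio tends to `1`. -/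
def AsympEq (u v : ℝ → ℝ≥0∞) : Prop :=
  Tendsto (fun α : ℝ => u α / v α) (𝓝[>] 0) (𝓝 1)

end

end QCD

/-!
The proof has three ingredients.

*Optional skipping.* Whether an observation is used depends only on the earlier used observations
and on deterministic waiting times. Deleting the skipped observations from an independent sequence
therefore does not change its law (`Control.lintegral_compress`). Skipped observations contribute
nothing to the detection statistic of the GDECuSum test, so that on every path the GCuSum test run
on the used observations stops no later (`firstPassage_le_of_count`). Taking expectations without
a change compares the false alarm rates (`far_gdecusum_le`), and with a change at time `1` it shows
that lower bounds for the delay of GCuSum are inherited by GDECuSum. The duty cycles agree because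
the recursions of GDECuSum and DECuSum produce the same statistic on every path (`gdState_spec`).

*Delay.* For `∑ x i` close to `l m`, where `m` is the mean under `f θ`, Gibbs' inequality
(`mean_llr_le`) bounds `θ' ∑ x i - l b θ'` for all `θ'` simultaneously by `l D(f θ ‖ f₀)` plus a
multiple of the fluctuation of `∑ x i`, and the strong law controls the latter; this is the lower
bound (`lintegral_firstPassage_ge`). For the upper bound, the sum of the log-likelihood ratios of
`f θ` over the observations used since the change point is compared with the threshold. The
Lyapunov function `(A + c - u) / d + V w` (`lintegral_hit_le`) bounds the mean number of steps
given any past: its first part is Wald's identity for increments truncated at `c`, and its second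
part bounds the number of skipped observations. For the latter, the positive drift of the least
favorable log-likelihood ratio and the exponential moment supplied by the exponential family make
`e^{-t W}` a supermartingale while observations are used, so that the number of skipping phases has
a bounded mean, and `h < ∞` bounds their length (`exists_potential`).

*False alarms.* Since `θ > 0`, the likelihood ratio of each `f θ` is an increasing function of
the sum of the observations. The events that it exceeds a level are nested, and the supremum over
`θ` costs only a constant factor in Chernoff's bound (`measure_sup_ge_le_exp`). Long sums are
excluded by a Chernoff bound with geometric decay (`measure_sup_ge_le_pow`), and a union bound
gives a false alarm rate of at most `K (1 + A) e^{-A}` (`far_gcusum_le`).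
-/

namespace QCD

/-! ### Sequences of observations and product measures -/

/-- The sequence without its first term. -/
def tail (x : ℕ → ℝ) : ℕ → ℝ := fun n => x (n + 1)

/-- The sequence `a, x 0, x 1, …`. -/
def cons (a : ℝ) (x : ℕ → ℝ) : ℕ → ℝ
  | 0 => a
  | n + 1 => x n

/-- The first `γ` terms of `x`, followed by the whole sequence `y`. -/
def splice (γ : ℕ) (x y : ℕ → ℝ) : ℕ → ℝ := fun n => if n < γ then x n else y (n - γ)

/-- The law of a sequence of independent observations with common law `ρ`. -/
noncomputable abbrev iid (ρ : Measure ℝ) : Measure (ℕ → ℝ) := Measure.infinitePi fun _ : ℕ => ρ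

@[simp] lemma tail_cons (a : ℝ) (x : ℕ → ℝ) : tail (cons a x) = x := rfl

@[simp] lemma cons_zero (a : ℝ) (x : ℕ → ℝ) : cons a x 0 = a := rfl

@[simp] lemma cons_succ (a : ℝ) (x : ℕ → ℝ) (n : ℕ) : cons a x (n + 1) = x n := rfl

lemma splice_one (x y : ℕ → ℝ) : splice 1 x y = cons (x 0) y := by
  funext n
  cases n <;> simp [splice]

@[fun_prop] lemma measurable_tail : Measurable tail := by
  unfold tail; fun_prop

lemma measurable_cons : Measurable fun p : ℝ × (ℕ → ℝ) => cons p.1 p.2 := by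
  refine measurable_pi_iff.2 fun n => ?_
  cases n
  · exact measurable_fst
  · exact (measurable_pi_apply _).comp measurable_snd

@[fun_prop] lemma measurable_cons_comp {α : Type*} [MeasurableSpace α] {f : α → ℝ} {g : α → ℕ → ℝ}
    (hf : Measurable f) (hg : Measurable g) : Measurable fun a => cons (f a) (g a) :=
  measurable_cons.comp (hf.prodMk hg)

lemma measurable_splice (γ : ℕ) :
    Measurable fun p : (ℕ → ℝ) × (ℕ → ℝ) => splice γ p.1 p.2 := by
  refine measurable_pi_iff.2 fun n => ?_
  unfold splice
  by_cases h : n < γ <;> simp only [h, if_true, if_false] <;> fun_prop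

/-- Independent sequences, spliced together, are again independent. -/
lemma map_splice (γ : ℕ) (a b : ℕ → Measure ℝ) [∀ n, IsProbabilityMeasure (a n)]
    [∀ n, IsProbabilityMeasure (b n)] :
    ((Measure.infinitePi a).prod (Measure.infinitePi b)).map (fun p => splice γ p.1 p.2)
      = Measure.infinitePi (fun n => if n < γ then a n else b (n - γ)) := by
  have hp : ∀ n, IsProbabilityMeasure (if n < γ then a n else b (n - γ)) := by
    intro n; split_ifs <;> infer_instance
  refine Measure.eq_infinitePi _ fun s t ht => ?_
  rw [Measure.map_apply (measurable_splice γ)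
    (MeasurableSet.pi s.countable_toSet fun i _ => ht i)]
  have hpre : (fun p : (ℕ → ℝ) × (ℕ → ℝ) => splice γ p.1 p.2) ⁻¹' Set.pi s t
      = (Set.pi (s.filter (· < γ) : Finset ℕ) t) ×ˢ
        (Set.pi ((s.filter (¬ · < γ)).image (· - γ) : Finset ℕ) fun n => t (n + γ)) := by
    ext ⟨x, y⟩
    simp only [Set.mem_preimage, Set.mem_pi, Set.mem_prod, Finset.mem_coe, Finset.mem_filter,
      Finset.mem_image, splice]
    constructor
    · intro h
      refine ⟨fun i hi => by simpa [hi.2] using h i hi.1, ?_⟩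
      rintro _ ⟨i, hi, rfl⟩
      have := h i hi.1
      rw [if_neg hi.2] at this
      rwa [Nat.sub_add_cancel (not_lt.1 hi.2)]
    · rintro ⟨h1, h2⟩ i hi
      by_cases hc : i < γ
      · simpa [hc] using h1 i ⟨hi, hc⟩
      · have := h2 (i - γ) ⟨i, ⟨hi, hc⟩, rfl⟩
        rw [Nat.sub_add_cancel (not_lt.1 hc)] at this
        simpa [hc] using this
  rw [hpre, Measure.prod_prod, Measure.infinitePi_pi _ fun i _ => ht i,
    Measure.infinitePi_pi _ fun i _ => ht _, Finset.prod_image,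
    ← Finset.prod_filter_mul_prod_filter_not s (· < γ)]
  · congr 1
    · refine Finset.prod_congr rfl fun i hi => ?_
      rw [if_pos (Finset.mem_filter.1 hi).2]
    · refine Finset.prod_congr rfl fun i hi => ?_
      have h := (Finset.mem_filter.1 hi).2
      rw [if_neg h, Nat.sub_add_cancel (not_lt.1 h)]
  · intro i hi j hj hij
    simp only [Finset.coe_filter, Set.mem_ofPred_eq] at hi hj
    simp only at hij
    omega

lemma lintegral_cons (ρ : Measure ℝ) [IsProbabilityMeasure ρ] {F : (ℕ → ℝ) → ℝ≥0∞}
    (hF : Measurable F) :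
    ∫⁻ x, F x ∂(iid ρ) = ∫⁻ a, ∫⁻ y, F (cons a y) ∂(iid ρ) ∂ρ := by
  have h := map_splice 1 (fun _ => ρ) (fun _ => ρ)
  simp only [ite_self] at h
  conv_lhs => rw [iid, ← h]
  rw [lintegral_map hF (measurable_splice 1), lintegral_prod _ (by
    exact (hF.comp (measurable_splice 1)).aemeasurable)]
  simp only [splice_one]
  have h2 : Measurable fun a => ∫⁻ y, F (cons a y) ∂(iid ρ) :=
    Measurable.lintegral_prod_right' (hF.comp measurable_cons)
  exact (measurePreserving_eval_infinitePi (fun _ : ℕ => ρ) 0).lintegral_comp h2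

lemma map_tail_iid (ρ : Measure ℝ) [IsProbabilityMeasure ρ] : (iid ρ).map tail = iid ρ :=
  Measure.map_infinitePi_infinitePi_of_inj (P := fun _ : ℕ => ρ) (f := fun n : ℕ => n + 1)
    (add_left_injective 1)

lemma isProbabilityMeasure_obsLaw {ν : Measure ℝ} {g : ℝ → ℝ} (hg : IsPDF ν g) :
    IsProbabilityMeasure (obsLaw ν g) :=
  ⟨by rw [obsLaw, withDensity_apply _ MeasurableSet.univ, Measure.restrict_univ, hg.2.2]⟩

lemma isProbabilityMeasure_lawChange {ν : Measure ℝ} {f₀ g : ℝ → ℝ} (hf₀ : IsPDF ν f₀)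
    (hg : IsPDF ν g) (γ : ℕ) : IsProbabilityMeasure (lawChange ν f₀ g γ) := by
  have := isProbabilityMeasure_obsLaw hf₀
  have := isProbabilityMeasure_obsLaw hg
  have hp : ∀ n, IsProbabilityMeasure (if n < γ then obsLaw ν f₀ else obsLaw ν g) := by
    intro n; split_ifs <;> infer_instance
  unfold lawChange; infer_instance

lemma lawChange_eq_map_splice {ν : Measure ℝ} {f₀ g : ℝ → ℝ} (hf₀ : IsPDF ν f₀)
    (hg : IsPDF ν g) (γ : ℕ) :
    lawChange ν f₀ g γ = ((iid (obsLaw ν f₀)).prod (iid (obsLaw ν g))).map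
      fun p => splice γ p.1 p.2 := by
  have := isProbabilityMeasure_obsLaw hf₀
  have := isProbabilityMeasure_obsLaw hg
  rw [map_splice]; rfl

lemma map_tail_lawChange_one {ν : Measure ℝ} {f₀ g : ℝ → ℝ} (hf₀ : IsPDF ν f₀)
    (hg : IsPDF ν g) : (lawChange ν f₀ g 1).map tail = iid (obsLaw ν g) := by
  have := isProbabilityMeasure_obsLaw hf₀
  have := isProbabilityMeasure_obsLaw hg
  rw [lawChange_eq_map_splice hf₀ hg, Measure.map_map measurable_tail (measurable_splice 1)]
  simp only [Function.comp_def, splice_one, tail_cons]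
  exact Measure.map_snd_prod.trans (by simp)

/-! ### First passage times of the generalized likelihood ratio statistic -/

lemma firstPassage_le_of_le {G : ℕ → EReal} {A : ℝ} {n : ℕ} (hn : 1 ≤ n) (h : (A : EReal) ≤ G n) :
    firstPassage G A ≤ n :=
  iInf₂_le n ⟨hn, h⟩

lemma firstPassage_le_iff {G : ℕ → EReal} {A : ℝ} {n : ℕ} :
    firstPassage G A ≤ n ↔ ∃ m, 1 ≤ m ∧ m ≤ n ∧ (A : EReal) ≤ G m := by
  constructor
  · intro h
    by_contra! hc
    have h1 : ((n + 1 : ℕ) : ℕ∞) ≤ firstPassage G A := by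
      refine le_iInf₂ fun m hm => ?_
      by_contra! hlt
      have : m ≤ n := Nat.lt_succ_iff.1 (by exact_mod_cast hlt)
      exact absurd hm.2 (not_le.2 (hc m hm.1 this))
    have h2 := h1.trans h
    have : n + 1 ≤ n := by exact_mod_cast h2
    omega
  · rintro ⟨m, h1, h2, h3⟩
    exact (firstPassage_le_of_le h1 h3).trans (by exact_mod_cast h2)

lemma firstPassage_congr {G G' : ℕ → EReal} {A : ℝ} (h : ∀ n, 1 ≤ n → G n = G' n) :
    firstPassage G A = firstPassage G' A := by
  unfold firstPassage
  refine iInf_congr fun n => iInf_congr_Prop ?_ fun _ => rfl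
  constructor <;> rintro ⟨h1, h2⟩ <;> refine ⟨h1, ?_⟩
  · rwa [← h n h1]
  · rwa [h n h1]

lemma usedSum_congr {s s' : ℕ → ℝ} {x x' : ℕ → ℝ} (L : ℝ → ℝ) {k n : ℕ} (hk : 1 ≤ k)
    (hs : ∀ i, 1 ≤ i → s i = s' i) (hx : ∀ i, 1 ≤ i → x i = x' i) :
    usedSum s L x k n = usedSum s' L x' k n := by
  refine Finset.sum_congr rfl fun i hi => ?_
  have : 1 ≤ i := hk.trans (Finset.mem_Icc.1 hi).1
  rw [hs i this, hx i this]

lemma glrStat_congr {f₀ : ℝ → ℝ} {f : ℝ → ℝ → ℝ} {Θ : Set ℝ} {s s' : ℕ → ℝ} {x x' : ℕ → ℝ} {n : ℕ}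
    (hs : ∀ i, 1 ≤ i → s i = s' i) (hx : ∀ i, 1 ≤ i → x i = x' i) :
    glrStat f₀ f Θ s x n = glrStat f₀ f Θ s' x' n := by
  unfold glrStat
  refine iSup_congr fun k => iSup_congr fun hk => iSup_congr fun θ => iSup_congr fun _ => ?_
  rw [usedSum_congr _ (Finset.mem_Icc.1 hk).1 hs hx]

lemma le_glrStat {f₀ : ℝ → ℝ} {f : ℝ → ℝ → ℝ} {Θ : Set ℝ} {s : ℕ → ℝ} {x : ℕ → ℝ} {n k : ℕ}
    (hk : k ∈ Finset.Icc 1 n) :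
    ⨆ θ ∈ Θ, ((usedSum s (llr f₀ (f θ)) x k n : ℝ) : EReal) ≤ glrStat f₀ f Θ s x n :=
  le_iSup₂ (f := fun k (_ : k ∈ Finset.Icc 1 n) =>
    ⨆ θ ∈ Θ, ((usedSum s (llr f₀ (f θ)) x k n : ℝ) : EReal)) k hk

/-- The maximum over the starting points `k` is attained. -/
lemma le_glrStat_iff {f₀ : ℝ → ℝ} {f : ℝ → ℝ → ℝ} {Θ : Set ℝ} {s : ℕ → ℝ} {x : ℕ → ℝ} {n : ℕ}
    {A : ℝ} : (A : EReal) ≤ glrStat f₀ f Θ s x n ↔ ∃ k ∈ Finset.Icc 1 n,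
      (A : EReal) ≤ ⨆ θ ∈ Θ, ((usedSum s (llr f₀ (f θ)) x k n : ℝ) : EReal) := by
  constructor
  · intro h
    by_contra! hc
    have := (Finset.sup_lt_iff (EReal.bot_lt_coe A)).2 hc
    rw [Finset.sup_eq_iSup] at this
    exact absurd h (not_le.2 this)
  · rintro ⟨k, hk, h⟩
    exact h.trans (le_glrStat hk)

/-- Suppose that `y` lists the used terms of `x` up to time `N`, `c n` being the number of those
used up to time `n`. If the statistic of the used observations crosses `A > 0` before `N`, then the
statistic of all terms of `y` does so no later: skipped observations only add waiting time. -/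
lemma firstPassage_le_of_count {f₀ : ℝ → ℝ} {f : ℝ → ℝ → ℝ} {Θ : Set ℝ} {s x y : ℕ → ℝ} {c : ℕ → ℕ}
    {N n : ℕ} {A : ℝ} (hA : 0 < A) (hc0 : c 0 = 0)
    (hc : ∀ i < N, (s (i + 1) = 1 ∧ c (i + 1) = c i + 1 ∧ y (c i + 1) = x (i + 1)) ∨
      (s (i + 1) = 0 ∧ c (i + 1) = c i)) (hn : n ≤ N)
    (h : firstPassage (glrStat f₀ f Θ s x) A ≤ n) :
    firstPassage (glrStat f₀ f Θ (fun _ => 1) y) A ≤ n := by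
  have hcle : ∀ j ≤ N, c j ≤ j := by
    intro j
    induction j with
    | zero => simp [hc0]
    | succ j ih =>
      intro hj
      have := ih (by omega)
      rcases hc j (by omega) with h1 | h1 <;> omega
  have hsum : ∀ L : ℝ → ℝ, ∀ k j, k ≤ j → j ≤ N → c k ≤ c j ∧
      usedSum s L x (k + 1) j = usedSum (fun _ => 1) L y (c k + 1) (c j) := by
    intro L k j hkj
    induction j, hkj using Nat.le_induction with
    | base => intro _; simp [usedSum]
    | succ j hkj ih =>
      intro hj
      obtain ⟨ih1, ih2⟩ := ih (by omega)
      unfold usedSum at ih2 ⊢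
      rw [Finset.sum_Icc_succ_top (by omega), ih2]
      rcases hc j (by omega) with ⟨h1, h2, h3⟩ | ⟨h1, h2⟩
      · rw [h2, Finset.sum_Icc_succ_top (by omega), h1, h3]
        exact ⟨by omega, rfl⟩
      · rw [h2, h1]
        exact ⟨ih1, by ring⟩
  obtain ⟨j, hj1, hjn, hj⟩ := firstPassage_le_iff.1 h
  obtain ⟨k, hk, hkA⟩ := le_glrStat_iff.1 hj
  obtain ⟨hk1, hkj⟩ := Finset.mem_Icc.1 hk
  obtain ⟨k, rfl⟩ : ∃ k', k = k' + 1 := ⟨k - 1, by omega⟩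
  have hle := (hsum id k j (by omega) (by omega)).1
  have hlt : c k < c j := by
    refine lt_of_le_of_ne hle fun he => ?_
    have hle0 : ⨆ θ ∈ Θ, ((usedSum s (llr f₀ (f θ)) x (k + 1) j : ℝ) : EReal) ≤ 0 := by
      refine iSup₂_le fun θ _ => ?_
      rw [(hsum _ k j (by omega) (by omega)).2, he]
      simp [usedSum]
    have : (A : EReal) ≤ 0 := hkA.trans hle0
    exact absurd (by exact_mod_cast this) (not_le.2 hA)
  refine firstPassage_le_iff.2 ⟨c j, by omega, (hcle j (by omega)).trans hjn, ?_⟩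
  refine le_glrStat_iff.2 ⟨c k + 1, Finset.mem_Icc.2 ⟨by omega, by omega⟩, hkA.trans_eq ?_⟩
  refine iSup_congr fun θ => iSup_congr fun _ => ?_
  rw [(hsum _ k j (by omega) (by omega)).2]

/-! ### Observation controls driven by a real state -/

/-- A rule that uses the next observation if and only if its state `w` is nonnegative. The state
then moves to `adv w x`, where `x` is the observation, and otherwise to `skip w`. -/
structure Control where
  /-- the next state after an observation has been used -/
  adv : ℝ → ℝ → ℝ
  /-- the next state after an observation has been skipped -/
  skip : ℝ → ℝ
  measurable_adv : Measurable (Function.uncurry adv)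
  measurable_skip : Measurable skip

namespace Control

variable (C : Control)

/-- The state that follows `w` if the next observation is `x`. -/
noncomputable def step (w x : ℝ) : ℝ := if 0 ≤ w then C.adv w x else C.skip w

/-- The state after `n` observations `x 0, …, x (n - 1)`, started in `w`. -/
noncomputable def state : ℕ → ℝ → (ℕ → ℝ) → ℝ
  | 0, w, _ => w
  | n + 1, w, x => state n (C.step w (x 0)) (tail x)

/-- The number of used observations among the first `n`. -/
noncomputable def count : ℕ → ℝ → (ℕ → ℝ) → ℕ
  | 0, _, _ => 0
  | n + 1, w, x => (if 0 ≤ w then 1 else 0) + count n (C.step w (x 0)) (tail x)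

/-- The sequence from which the observations skipped among the first `n` have been deleted. -/
noncomputable def compress : ℕ → ℝ → (ℕ → ℝ) → ℕ → ℝ
  | 0, _, x => x
  | n + 1, w, x => if 0 ≤ w then cons (x 0) (compress n (C.adv w (x 0)) (tail x))
    else compress n (C.skip w) (tail x)

/-- The indicator that `x n` is used, for the control started in `0` before `x 1` is seen. -/
noncomputable def used (x : ℕ → ℝ) (n : ℕ) : ℝ := if 0 ≤ C.state (n - 1) 0 (tail x) then 1 else 0

lemma measurable_step : Measurable fun p : ℝ × ℝ => C.step p.1 p.2 := by
  unfold step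
  exact Measurable.ite (measurableSet_le measurable_const measurable_fst) C.measurable_adv
    (C.measurable_skip.comp measurable_fst)

lemma state_succ (n : ℕ) (w : ℝ) (x : ℕ → ℝ) :
    C.state (n + 1) w x = C.step (C.state n w x) (x n) := by
  induction n generalizing w x with
  | zero => rfl
  | succ n ih => rw [state, ih, state]; rfl

lemma count_succ (n : ℕ) (w : ℝ) (x : ℕ → ℝ) :
    C.count (n + 1) w x = C.count n w x + if 0 ≤ C.state n w x then 1 else 0 := by
  induction n generalizing w x with
  | zero => by_cases h : 0 ≤ w <;> simp [count, state, h]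
  | succ n ih => rw [count, ih, count, state, add_assoc]

lemma state_congr {n : ℕ} {w : ℝ} {x x' : ℕ → ℝ} (h : ∀ i < n, x i = x' i) :
    C.state n w x = C.state n w x' := by
  induction n with
  | zero => rfl
  | succ n ih => rw [state_succ, state_succ, ih fun i hi => h i (by omega), h n (by omega)]

lemma state_add (m n : ℕ) (w : ℝ) (x : ℕ → ℝ) :
    C.state (m + n) w x = C.state n (C.state m w x) fun i => x (m + i) := by
  induction n with
  | zero => rfl
  | succ n ih => rw [← add_assoc, state_succ, state_succ, ih]

lemma measurable_state (n : ℕ) (w : ℝ) : Measurable fun x => C.state n w x := by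
  induction n with
  | zero => exact measurable_const
  | succ n ih =>
    simp only [state_succ]
    exact C.measurable_step.comp (ih.prodMk (measurable_pi_apply n))

lemma measurable_used (n : ℕ) : Measurable fun x => C.used x n :=
  Measurable.ite (measurableSet_le measurable_const
    ((C.measurable_state (n - 1) 0).comp measurable_tail)) measurable_const measurable_const

lemma compress_count {n i : ℕ} {w : ℝ} {x : ℕ → ℝ} (hi : i < n) (h : 0 ≤ C.state i w x) :
    C.compress n w x (C.count i w x) = x i := by
  induction n generalizing i w x with
  | zero => omega
  | succ n ih =>
    cases i with
    | zero => simp [count, compress, show 0 ≤ w from h]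
    | succ i =>
      have := ih (i := i) (by omega) h
      by_cases hw : 0 ≤ w
      · simp only [step, hw, if_true] at this
        simp only [count, compress, step, hw, if_true]
        rw [add_comm, cons_succ, this]; rfl
      · simp only [step, hw, if_false] at this
        simp only [count, compress, step, hw, if_false]
        rw [zero_add, this]; rfl

lemma measurable_compress (n : ℕ) :
    Measurable fun p : ℝ × (ℕ → ℝ) => C.compress n p.1 p.2 := by
  induction n with
  | zero => exact measurable_snd
  | succ n ih =>
    have h0 : Measurable fun p : ℝ × (ℕ → ℝ) => p.2 0 := by fun_prop
    have ht : Measurable fun p : ℝ × (ℕ → ℝ) => tail p.2 := measurable_tail.comp measurable_snd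
    unfold compress
    refine Measurable.ite (measurableSet_le measurable_const measurable_fst) ?_ ?_
    · exact measurable_cons_comp h0
        (ih.comp ((C.measurable_adv.comp (measurable_fst.prodMk h0)).prodMk ht))
    · exact ih.comp ((C.measurable_skip.comp measurable_fst).prodMk ht)

/-- Optional skipping: whether an observation is used depends only on earlier observations, so that
deleting the skipped ones does not change the law of an independent sequence. -/
lemma lintegral_compress (ρ : Measure ℝ) [IsProbabilityMeasure ρ] (n : ℕ) (w : ℝ)
    {F : (ℕ → ℝ) → ℝ≥0∞} (hF : Measurable F) :
    ∫⁻ x, F (C.compress n w x) ∂(iid ρ) = ∫⁻ x, F x ∂(iid ρ) := by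
  induction n generalizing w F with
  | zero => rfl
  | succ n ih =>
    rw [lintegral_cons ρ (F := fun x => F (C.compress (n + 1) w x))
      (hF.comp ((C.measurable_compress (n + 1)).comp (measurable_const.prodMk measurable_id)))]
    by_cases hw : 0 ≤ w
    · simp only [compress, hw, if_true, tail_cons, cons_zero]
      rw [lintegral_cons ρ hF]
      refine lintegral_congr fun a => ?_
      exact ih (C.adv w a) (F := fun y => F (cons a y)) (by fun_prop)
    · simp only [compress, hw, if_false, tail_cons, ih _ hF]
      simp

/-- Under any law that makes the observations from time `1` on independent with common law `ρ`, the
mean stopping time of the controlled test is at least that of the test that uses every observation. -/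
lemma lintegral_firstPassage_le {f₀ : ℝ → ℝ} {f : ℝ → ℝ → ℝ} {Θ : Set ℝ} {A : ℝ} (hA : 0 < A)
    {ρ : Measure ℝ} [IsProbabilityMeasure ρ] {P : Measure (ℕ → ℝ)} (hP : P.map tail = iid ρ)
    (hmeas : Measurable fun y => firstPassage (glrStat f₀ f Θ (fun _ => 1) (cons 0 y)) A) :
    ∫⁻ y, (firstPassage (glrStat f₀ f Θ (fun _ => 1) (cons 0 y)) A : ℝ≥0∞) ∂(iid ρ)
      ≤ ∫⁻ x, (firstPassage (glrStat f₀ f Θ (C.used x) x) A : ℝ≥0∞) ∂P := by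
  set T : (ℕ → ℝ) → ℕ∞ := fun y => firstPassage (glrStat f₀ f Θ (fun _ => 1) (cons 0 y)) A
  have hT : Measurable fun y => ((T y : ℕ∞) : ℝ≥0∞) := (measurable_from_top).comp hmeas
  have hpath : ∀ N : ℕ, ∀ x, min (T (C.compress N 0 (tail x)) : ℝ≥0∞) (N : ℝ≥0∞)
      ≤ (firstPassage (glrStat f₀ f Θ (C.used x) x) A : ℝ≥0∞) := by
    intro N x
    set t := firstPassage (glrStat f₀ f Θ (C.used x) x) A with ht
    by_cases htN : t ≤ (N : ℕ∞)
    · refine (min_le_left _ _).trans ?_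
      obtain ⟨n, hn⟩ := ENat.ne_top_iff_exists.1 (ne_top_of_le_ne_top (ENat.natCast_ne_top N) htN)
      have hnN : n ≤ N := by rw [← hn] at htN; exact_mod_cast htN
      have := firstPassage_le_of_count (f₀ := f₀) (f := f) (Θ := Θ) (s := C.used x) (x := x)
        (y := cons 0 (C.compress N 0 (tail x))) (c := fun n => C.count n 0 (tail x)) hA rfl
        (N := N) (n := n) ?_ hnN (by rw [← ht, hn])
      · rw [← hn]
        exact ENat.toENNReal_le.2 this
      · intro i hi
        rw [count_succ]
        by_cases h : 0 ≤ C.state i 0 (tail x)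
        · refine Or.inl ⟨by simp [used, h], by simp [h], ?_⟩
          rw [cons_succ, C.compress_count hi h]; rfl
        · exact Or.inr ⟨by simp [used, h], by simp [h]⟩
    · refine (min_le_right _ _).trans ?_
      have : (N : ℕ∞) ≤ t := (not_le.1 htN).le
      simpa using ENat.toENNReal_le.2 this
  have hN : ∀ N : ℕ, ∫⁻ y, min (T y : ℝ≥0∞) (N : ℝ≥0∞) ∂(iid ρ)
      ≤ ∫⁻ x, (firstPassage (glrStat f₀ f Θ (C.used x) x) A : ℝ≥0∞) ∂P := by
    intro N
    have hm : Measurable fun y => min (T y : ℝ≥0∞) (N : ℝ≥0∞) := hT.min measurable_const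
    rw [← C.lintegral_compress ρ N 0 hm, ← hP]
    exact (lintegral_map_le _ _).trans (lintegral_mono fun x => hpath N x)
  have hsup : ∀ y, (T y : ℝ≥0∞) = ⨆ N : ℕ, min (T y : ℝ≥0∞) (N : ℝ≥0∞) := by
    intro y
    rw [← inf_iSup_eq]
    simp [ENNReal.iSup_natCast]
  calc ∫⁻ y, (T y : ℝ≥0∞) ∂(iid ρ)
      = ∫⁻ y, ⨆ N : ℕ, min (T y : ℝ≥0∞) (N : ℝ≥0∞) ∂(iid ρ) := lintegral_congr hsup
    _ = ⨆ N : ℕ, ∫⁻ y, min (T y : ℝ≥0∞) (N : ℝ≥0∞) ∂(iid ρ) := by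
        refine lintegral_iSup (fun N => hT.min measurable_const) ?_
        intro a b hab y
        exact min_le_min le_rfl (by exact_mod_cast hab)
    _ ≤ _ := iSup_le hN

end Control

/-! ### Upper bound for the detection delay -/

namespace Control

variable (C : Control)

/-- The sum, started in `u`, of the increments `L` of the used observations among the first `n`. -/
noncomputable def total (L : ℝ → ℝ) : ℕ → ℝ → ℝ → (ℕ → ℝ) → ℝ
  | 0, _, u, _ => u
  | n + 1, w, u, x =>
    total L n (C.step w (x 0)) (if 0 ≤ w then u + L (x 0) else u) (tail x)

/-- The smaller of `n` and the first time at which `total L` is at least `A`. -/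
noncomputable def hit (L : ℝ → ℝ) (A : ℝ) : ℕ → ℝ → ℝ → (ℕ → ℝ) → ℝ≥0∞
  | 0, _, _, _ => 0
  | n + 1, w, u, x => if A ≤ u then 0
    else 1 + hit L A n (C.step w (x 0)) (if 0 ≤ w then u + L (x 0) else u) (tail x)

lemma total_succ (L : ℝ → ℝ) (n : ℕ) (w u : ℝ) (x : ℕ → ℝ) :
    C.total L (n + 1) w u x = C.total L n w u x + if 0 ≤ C.state n w x then L (x n) else 0 := by
  induction n generalizing w u x with
  | zero => by_cases h : 0 ≤ w <;> simp [total, state, h]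
  | succ n ih => rw [total, ih, total, state]; rfl

lemma hit_mono (L : ℝ → ℝ) (A : ℝ) (n : ℕ) (w u : ℝ) (x : ℕ → ℝ) :
    C.hit L A n w u x ≤ C.hit L A (n + 1) w u x := by
  induction n generalizing w u x with
  | zero => exact zero_le
  | succ n ih =>
    rw [hit, hit]
    split_ifs with h
    · exact le_rfl
    all_goals exact add_le_add le_rfl (ih _ _ _)

lemma le_hit_or (L : ℝ → ℝ) (A : ℝ) (n : ℕ) (w u : ℝ) (x : ℕ → ℝ) :
    (n : ℝ≥0∞) ≤ C.hit L A n w u x ∨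
      ∃ j : ℕ, C.hit L A n w u x = j ∧ A ≤ C.total L j w u x := by
  induction n generalizing w u x with
  | zero => left; simp
  | succ n ih =>
    rw [hit]
    split_ifs with h h'
    · exact Or.inr ⟨0, by simp, h⟩
    all_goals
      rcases ih (C.step w (x 0)) (if 0 ≤ w then u + L (x 0) else u) (tail x) with h1 | ⟨j, h1, h2⟩
      · left
        simp only [h', if_true, if_false] at h1
        push_cast
        rw [add_comm]
        exact add_le_add le_rfl h1
      · right
        refine ⟨j + 1, ?_, h2⟩
        simp only [h', if_true, if_false] at h1
        rw [h1]
        push_cast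
        rw [add_comm]

lemma measurable_hit {L : ℝ → ℝ} (hL : Measurable L) (A : ℝ) (n : ℕ) :
    Measurable fun p : ℝ × ℝ × (ℕ → ℝ) => C.hit L A n p.1 p.2.1 p.2.2 := by
  induction n with
  | zero => exact measurable_const
  | succ n ih =>
    have h0 : Measurable fun p : ℝ × ℝ × (ℕ → ℝ) => p.2.2 0 := by fun_prop
    have ht : Measurable fun p : ℝ × ℝ × (ℕ → ℝ) => tail p.2.2 := by fun_prop
    have hu : Measurable fun p : ℝ × ℝ × (ℕ → ℝ) => p.2.1 := by fun_prop
    unfold hit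
    refine Measurable.ite (measurableSet_le measurable_const hu) measurable_const ?_
    refine measurable_const.add (ih.comp (Measurable.prodMk ?_ (Measurable.prodMk ?_ ht)))
    · exact C.measurable_step.comp (measurable_fst.prodMk h0)
    · exact Measurable.ite (measurableSet_le measurable_const measurable_fst)
        (hu.add (hL.comp h0)) hu

/-- The Lyapunov bound. While `total L` is below `A`, the potential `(A + c - u) / d + V w` drops
on average by at least `1` per step: by the first term if the observation is used, the mean
increment being `d`, and by the second if it is skipped. Increments at most `c` bound the
overshoot, so that the potential stays nonnegative. -/
lemma lintegral_hit_le {ρ : Measure ℝ} [IsProbabilityMeasure ρ] {L : ℝ → ℝ} (hL : Measurable L)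
    (hLi : Integrable L ρ) {A c d : ℝ} (hLc : ∀ x, L x ≤ c) (hd : ∫ x, L x ∂ρ = d) (hd0 : 0 < d)
    {V : ℝ → ℝ} (hV0 : ∀ w, 0 ≤ V w) (hVi : ∀ w, 0 ≤ w → Integrable (fun x => V (C.adv w x)) ρ)
    (hVadv : ∀ w, 0 ≤ w → ∫ x, V (C.adv w x) ∂ρ ≤ V w)
    (hVskip : ∀ w, w < 0 → 1 + V (C.skip w) ≤ V w) (n : ℕ) (w u : ℝ) (hu : u ≤ A + c) :
    ∫⁻ x, C.hit L A n w u x ∂(iid ρ) ≤ ENNReal.ofReal ((A + c - u) / d + V w) := by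
  induction n generalizing w u with
  | zero => simp [hit]
  | succ n ih =>
    by_cases hA : A ≤ u
    · simp [hit, hA]
    have hA' : u < A := not_le.1 hA
    rw [lintegral_cons ρ (F := fun x => C.hit L A (n + 1) w u x)
      ((C.measurable_hit hL A (n + 1)).comp
        (measurable_const.prodMk (measurable_const.prodMk measurable_id)))]
    simp only [hit, hA, if_false, cons_zero, tail_cons]
    have hone : ∀ a, ∫⁻ y, (1 + C.hit L A n (C.step w a) (if 0 ≤ w then u + L a else u) y) ∂(iid ρ)
        = 1 + ∫⁻ y, C.hit L A n (C.step w a) (if 0 ≤ w then u + L a else u) y ∂(iid ρ) := by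
      intro a
      rw [lintegral_add_left measurable_const]
      simp
    simp only [hone]
    by_cases hw : 0 ≤ w
    · simp only [step, hw, if_true]
      have hpos : ∀ a, 0 ≤ (A + c - (u + L a)) / d + V (C.adv w a) := fun a =>
        add_nonneg (div_nonneg (by linarith [hLc a]) hd0.le) (hV0 _)
      have hu' : Integrable (fun a => u + L a) ρ := (integrable_const u).add hLi
      have hi : Integrable (fun a => (A + c - (u + L a)) / d) ρ :=
        ((integrable_const (A + c)).sub hu').div_const d
      have hiV : Integrable (fun a => (A + c - (u + L a)) / d + V (C.adv w a)) ρ :=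
        hi.add (hVi w hw)
      have h1V : Integrable (fun a => 1 + ((A + c - (u + L a)) / d + V (C.adv w a))) ρ :=
        (integrable_const 1).add hiV
      calc ∫⁻ a, (1 + ∫⁻ y, C.hit L A n (C.adv w a) (u + L a) y ∂(iid ρ)) ∂ρ
          ≤ ∫⁻ a, ENNReal.ofReal (1 + ((A + c - (u + L a)) / d + V (C.adv w a))) ∂ρ := by
            refine lintegral_mono fun a => ?_
            rw [ENNReal.ofReal_add zero_le_one (hpos a), ENNReal.ofReal_one]
            exact add_le_add le_rfl (ih _ _ (by linarith [hLc a]))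
        _ = ENNReal.ofReal (∫ a, (1 + ((A + c - (u + L a)) / d + V (C.adv w a))) ∂ρ) := by
            rw [ofReal_integral_eq_lintegral_ofReal h1V]
            exact Eventually.of_forall fun a => add_nonneg zero_le_one (hpos a)
        _ ≤ ENNReal.ofReal ((A + c - u) / d + V w) := by
            refine ENNReal.ofReal_le_ofReal ?_
            have e1 : ∫ a, (A + c - (u + L a)) / d ∂ρ = (A + c - (u + d)) / d := by
              rw [integral_div, integral_sub (integrable_const _) hu',
                integral_add (integrable_const _) hLi, hd]
              simp
            rw [integral_add (integrable_const _) hiV,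
              integral_add hi (hVi w hw), e1]
            have e2 : (A + c - (u + d)) / d = (A + c - u) / d - 1 := by field_simp; ring
            rw [e2]
            simp only [integral_const, probReal_univ, smul_eq_mul]
            linarith [hVadv w hw]
    · simp only [step, hw, if_false, lintegral_const, measure_univ, mul_one]
      refine (add_le_add le_rfl (ih (C.skip w) u hu)).trans ?_
      rw [← ENNReal.ofReal_one, ← ENNReal.ofReal_add zero_le_one
        (add_nonneg (div_nonneg (by linarith) hd0.le) (hV0 _))]
      exact ENNReal.ofReal_le_ofReal (by linarith [hVskip w (not_le.1 hw)])

end Control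

/-- The sequence `x` with its terms from `γ` on replaced by `0`. -/
def truncSeq (γ : ℕ) (x : ℕ → ℝ) : ℕ → ℝ := fun n => if n < γ then x n else 0

lemma measurable_truncSeq (γ : ℕ) : Measurable (truncSeq γ) := by
  refine measurable_pi_iff.2 fun n => ?_
  unfold truncSeq
  by_cases h : n < γ <;> simp only [h, if_true, if_false] <;> fun_prop

lemma truncSeq_splice (γ : ℕ) (x y : ℕ → ℝ) : truncSeq γ (splice γ x y) = truncSeq γ x := by
  funext n
  by_cases h : n < γ <;> simp [truncSeq, splice, h]

lemma setLIntegral_le_of_splice {ν : Measure ℝ} {f₀ g : ℝ → ℝ} (hf₀ : IsPDF ν f₀) (hg : IsPDF ν g)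
    (γ : ℕ) {F : (ℕ → ℝ) → ℝ≥0∞} (hF : Measurable F) {K : ℝ≥0∞}
    (hK : ∀ x, ∫⁻ y, F (splice γ x y) ∂(iid (obsLaw ν g)) ≤ K) {s : Set (ℕ → ℝ)}
    (hs : MeasurableSet s) :
    ∫⁻ z in truncSeq γ ⁻¹' s, F z ∂(lawChange ν f₀ g γ)
      ≤ K * lawChange ν f₀ g γ (truncSeq γ ⁻¹' s) := by
  have := isProbabilityMeasure_obsLaw hf₀
  have := isProbabilityMeasure_obsLaw hg
  have hs0 : MeasurableSet (truncSeq γ ⁻¹' s) := measurable_truncSeq γ hs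
  have hind : ∀ x y, (truncSeq γ ⁻¹' s).indicator F (splice γ x y)
      = (truncSeq γ ⁻¹' s).indicator (fun _ => F (splice γ x y)) x := by
    intro x y
    by_cases h : truncSeq γ x ∈ s <;> simp [Set.indicator, truncSeq_splice, h]
  have hmass : lawChange ν f₀ g γ (truncSeq γ ⁻¹' s)
      = iid (obsLaw ν f₀) (truncSeq γ ⁻¹' s) := by
    rw [lawChange_eq_map_splice hf₀ hg, Measure.map_apply (measurable_splice γ) hs0]
    have : (fun q : (ℕ → ℝ) × (ℕ → ℝ) => splice γ q.1 q.2) ⁻¹' (truncSeq γ ⁻¹' s)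
        = (truncSeq γ ⁻¹' s) ×ˢ Set.univ := by
      ext q; simp [truncSeq_splice]
    rw [this, Measure.prod_prod, measure_univ, mul_one]
  have hFs : Measurable ((truncSeq γ ⁻¹' s).indicator F) := hF.indicator hs0
  rw [hmass, ← lintegral_indicator hs0, lawChange_eq_map_splice hf₀ hg,
    lintegral_map hFs (measurable_splice γ),
    lintegral_prod (fun q => (truncSeq γ ⁻¹' s).indicator F (splice γ q.1 q.2))
      (hFs.comp (measurable_splice γ)).aemeasurable,
    ← lintegral_indicator_const hs0]
  refine lintegral_mono fun x => ?_
  simp only [hind]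
  by_cases hx : x ∈ truncSeq γ ⁻¹' s
  · simpa only [Set.indicator_of_mem hx] using hK x
  · simp only [Set.indicator_of_notMem hx, lintegral_zero, le_refl]

/-- If the information `m` is carried by the observations before the change, then a bound for the
mean of `F` that holds whatever these observations are bounds its conditional expectation. -/
lemma condLExp_le_of_splice {ν : Measure ℝ} {f₀ g : ℝ → ℝ} (hf₀ : IsPDF ν f₀) (hg : IsPDF ν g)
    (γ : ℕ) {F : (ℕ → ℝ) → ℝ≥0∞} (hF : Measurable F) {K : ℝ≥0∞}
    (hK : ∀ x, ∫⁻ y, F (splice γ x y) ∂(iid (obsLaw ν g)) ≤ K) {m : MeasurableSpace (ℕ → ℝ)}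
    (hm : m ≤ MeasurableSpace.comap (truncSeq γ) MeasurableSpace.pi) :
    ∀ᵐ z ∂(lawChange ν f₀ g γ), condLExp m (lawChange ν f₀ g γ) F z ≤ K := by
  have := isProbabilityMeasure_lawChange hf₀ hg γ
  have hm0 : m ≤ MeasurableSpace.pi := hm.trans (measurable_truncSeq γ).comap_le
  refine ae_le_of_ae_le_trim (hm := hm0) ?_
  refine ae_le_of_forall_setLIntegral_le_of_sigmaFinite
    (measurable_condLExp m _ F) fun s hs _ => ?_
  rw [setLIntegral_condLExp_trim hm0 _ _ hs, setLIntegral_const, trim_measurableSet_eq hm0 hs]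
  obtain ⟨s', hs', rfl⟩ := hm s hs
  exact setLIntegral_le_of_splice hf₀ hg γ hF hK hs'

namespace Control

variable (C : Control)

lemma info_le {Ψ : Policy} (hS : ∀ k x, 1 ≤ k → Ψ.S k x = C.used x k) (n : ℕ) :
    Ψ.info n ≤ MeasurableSpace.comap (truncSeq (n + 1)) MeasurableSpace.pi := by
  refine iSup₂_le fun k hk => ?_
  obtain ⟨hk1, hkn⟩ := Finset.mem_Icc.1 hk
  have hG : (fun x : ℕ → ℝ => (Ψ.S k x, Ψ.S k x * x k))
      = (fun x : ℕ → ℝ => (C.used x k, C.used x k * x k)) ∘ truncSeq (n + 1) := by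
    funext x
    have h1 : C.used (truncSeq (n + 1) x) k = C.used x k := by
      unfold used
      rw [C.state_congr (x' := tail x)]
      intro i hi
      simp [tail, truncSeq, show i < n by omega]
    simp only [Function.comp_apply, h1, hS k x hk1, truncSeq, show k < n + 1 by omega, if_true]
  rw [hG, ← MeasurableSpace.comap_comp]
  refine MeasurableSpace.comap_mono (Measurable.comap_le ?_)
  exact (C.measurable_used k).prodMk ((C.measurable_used k).mul (measurable_pi_apply k))

lemma total_le_usedSum {L L' : ℝ → ℝ} (hLL' : ∀ x, L x ≤ L' x) {γ : ℕ} (hγ : 1 ≤ γ) (z : ℕ → ℝ)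
    (j : ℕ) : C.total L j (C.state (γ - 1) 0 (tail z)) 0 (fun i => z (γ + i))
      ≤ ∑ i ∈ Finset.Ico γ (γ + j), C.used z i * L' (z i) := by
  induction j with
  | zero => simp [total]
  | succ j ih =>
    rw [total_succ, ← add_assoc, Finset.sum_Ico_succ_top (by omega)]
    refine add_le_add ih ?_
    have hst : C.state (γ + j - 1) 0 (tail z)
        = C.state j (C.state (γ - 1) 0 (tail z)) fun i => z (γ + i) := by
      rw [show γ + j - 1 = γ - 1 + j by omega, state_add]
      congr 1
      funext i
      exact congrArg z (by omega)
    unfold used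
    rw [hst]
    split_ifs
    · simpa using hLL' _
    · simp

/-- The delay is at most the time that the sum over the used observations from the change point on
takes to reach the threshold. -/
lemma firstPassage_sub_le {f₀ : ℝ → ℝ} {f : ℝ → ℝ → ℝ} {Θ : Set ℝ} {A : ℝ} (hA : 0 < A) {θ : ℝ}
    (hθ : θ ∈ Θ) {L : ℝ → ℝ} (hL : ∀ x, L x ≤ llr f₀ (f θ) x) {γ : ℕ} (hγ : 1 ≤ γ) (z : ℕ → ℝ) :
    (firstPassage (glrStat f₀ f Θ (C.used z) z) A : ℝ≥0∞) - (γ : ℝ≥0∞)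
      ≤ ⨆ n, C.hit L A n (C.state (γ - 1) 0 (tail z)) 0 fun i => z (γ + i) := by
  by_cases hall : ∀ n : ℕ, (n : ℝ≥0∞) ≤ C.hit L A n (C.state (γ - 1) 0 (tail z)) 0
      fun i => z (γ + i)
  · have : (⊤ : ℝ≥0∞) ≤ ⨆ n, C.hit L A n (C.state (γ - 1) 0 (tail z)) 0 fun i => z (γ + i) := by
      rw [← ENNReal.iSup_natCast]
      exact iSup_mono hall
    exact le_top.trans this
  · push Not at hall
    obtain ⟨n, hn⟩ := hall
    rcases C.le_hit_or L A n (C.state (γ - 1) 0 (tail z)) 0 (fun i => z (γ + i)) with h | ⟨j, h1, h2⟩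
    · exact absurd h (not_le.2 hn)
    have hj : 1 ≤ j := by
      by_contra hj
      obtain rfl : j = 0 := by omega
      exact absurd h2 (not_le.2 hA)
    have hfp : firstPassage (glrStat f₀ f Θ (C.used z) z) A ≤ ((γ + j - 1 : ℕ) : ℕ∞) := by
      refine firstPassage_le_of_le (by omega) (le_glrStat_iff.2
        ⟨γ, Finset.mem_Icc.2 ⟨hγ, by omega⟩, ?_⟩)
      refine le_trans ?_ (le_iSup₂ (f := fun θ (_ : θ ∈ Θ) =>
        ((usedSum (C.used z) (llr f₀ (f θ)) z γ (γ + j - 1) : ℝ) : EReal)) θ hθ)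
      refine EReal.coe_le_coe_iff.2 (h2.trans ((C.total_le_usedSum hL hγ z j).trans_eq ?_))
      refine Finset.sum_congr ?_ fun _ _ => rfl
      ext i
      simp only [Finset.mem_Ico, Finset.mem_Icc]
      omega
    refine le_trans ?_ (le_iSup _ n)
    rw [h1, tsub_le_iff_left]
    refine (ENat.toENNReal_le.2 hfp).trans ?_
    rw [ENat.toENNReal_coe]
    exact_mod_cast (by omega : γ + j - 1 ≤ γ + j)

lemma wadd_le {ν : Measure ℝ} {f₀ : ℝ → ℝ} {f : ℝ → ℝ → ℝ} {Θ : Set ℝ} {A : ℝ} (hA : 0 < A)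
    {Ψ : Policy} (hS : ∀ k x, 1 ≤ k → Ψ.S k x = C.used x k)
    (hτ : ∀ x, Ψ.τ x = firstPassage (glrStat f₀ f Θ (C.used x) x) A)
    (hf₀ : IsPDF ν f₀) {θ : ℝ} (hθ : θ ∈ Θ) (hg : IsPDF ν (f θ))
    {L : ℝ → ℝ} (hL : Measurable L) (hLi : Integrable L (obsLaw ν (f θ)))
    (hLL : ∀ x, L x ≤ llr f₀ (f θ) x) {c d : ℝ} (hc : 0 ≤ c) (hLc : ∀ x, L x ≤ c)
    (hd : ∫ x, L x ∂(obsLaw ν (f θ)) = d) (hd0 : 0 < d)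
    {V : ℝ → ℝ} (hV0 : ∀ w, 0 ≤ V w)
    (hVi : ∀ w, 0 ≤ w → Integrable (fun x => V (C.adv w x)) (obsLaw ν (f θ)))
    (hVadv : ∀ w, 0 ≤ w → ∫ x, V (C.adv w x) ∂(obsLaw ν (f θ)) ≤ V w)
    (hVskip : ∀ w, w < 0 → 1 + V (C.skip w) ≤ V w) {B : ℝ}
    (hVB : ∀ n x, V (C.state n 0 x) ≤ B) :
    WADD ν f₀ (f θ) Ψ ≤ ENNReal.ofReal ((A + c) / d + B) := by
  have := isProbabilityMeasure_obsLaw hg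
  refine iSup₂_le fun γ hγ => essSup_le_of_ae_le _ ?_
  set F : (ℕ → ℝ) → ℝ≥0∞ := fun z =>
    ⨆ n, C.hit L A n (C.state (γ - 1) 0 (tail z)) 0 fun i => z (γ + i) with hF
  have hFm : Measurable F := by
    refine Measurable.iSup fun n => (C.measurable_hit hL A n).comp
      (Measurable.prodMk ?_ (measurable_const.prodMk (by fun_prop)))
    exact (C.measurable_state (γ - 1) 0).comp measurable_tail
  have hle : condLExp (Ψ.info (γ - 1)) (lawChange ν f₀ (f θ) γ)
      (fun x => (Ψ.τ x : ℝ≥0∞) - (γ : ℝ≥0∞)) ≤ᵐ[lawChange ν f₀ (f θ) γ]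
      condLExp (Ψ.info (γ - 1)) (lawChange ν f₀ (f θ) γ) F := by
    refine condLExp_mono (Eventually.of_forall fun z => ?_)
    simp only [hτ]
    exact C.firstPassage_sub_le hA hθ hLL hγ z
  have hinfo := C.info_le hS (γ - 1)
  rw [Nat.sub_add_cancel hγ] at hinfo
  have hbound := condLExp_le_of_splice hf₀ hg γ hFm (K := ENNReal.ofReal ((A + c) / d + B))
    (fun x => ?_) hinfo
  · filter_upwards [hle, hbound] with z h1 h2 using h1.trans h2
  have hsp : ∀ y, F (splice γ x y)
      = ⨆ n, C.hit L A n (C.state (γ - 1) 0 (tail x)) 0 y := by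
    intro y
    have h1 : C.state (γ - 1) 0 (tail (splice γ x y)) = C.state (γ - 1) 0 (tail x) :=
      C.state_congr fun i hi => by simp [tail, splice, show i + 1 < γ by omega]
    have h2 : (fun i => splice γ x y (γ + i)) = y := by
      funext i
      simp [splice]
    simp only [hF, h1, h2]
  simp only [hsp]
  rw [lintegral_iSup]
  · refine iSup_le fun n => (C.lintegral_hit_le hL hLi hLc hd hd0 hV0 hVi hVadv hVskip n _ 0
      (by linarith)).trans (ENNReal.ofReal_le_ofReal ?_)
    rw [sub_zero]
    exact add_le_add le_rfl (hVB _ _)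
  · exact fun n => (C.measurable_hit hL A n).comp
      (measurable_const.prodMk (measurable_const.prodMk measurable_id))
  · exact monotone_nat_of_le_succ fun n y => C.hit_mono L A n _ _ y

end Control

/-! ### The controls of the three tests -/

/-- The control that uses every observation. -/
noncomputable def alwaysUse : Control where
  adv := fun _ _ => 0
  skip := fun _ => 0
  measurable_adv := measurable_const
  measurable_skip := measurable_const

lemma state_alwaysUse (n : ℕ) (x : ℕ → ℝ) : alwaysUse.state n 0 x = 0 := by
  induction n with
  | zero => rfl
  | succ n ih => rw [Control.state_succ, ih]; simp [Control.step, alwaysUse]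

lemma used_alwaysUse (x : ℕ → ℝ) : alwaysUse.used x = fun _ => 1 := by
  funext n
  simp [Control.used, state_alwaysUse]

lemma measurable_truncBelow (h : ℝ≥0∞) : Measurable (truncBelow h) := by
  unfold truncBelow
  split_ifs
  · exact measurable_id
  · exact measurable_id.max measurable_const

lemma le_truncBelow (h : ℝ≥0∞) (y : ℝ) : y ≤ truncBelow h y := by
  unfold truncBelow
  split_ifs
  · exact le_rfl
  · exact le_max_left _ _

lemma truncBelow_eq_or (h : ℝ≥0∞) (y : ℝ) : truncBelow h y = y ∨ truncBelow h y ≤ 0 := by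
  unfold truncBelow
  split_ifs
  · exact Or.inl rfl
  · rcases max_choice y (-h.toReal) with hm | hm
    · exact Or.inl hm
    · rw [hm]; exact Or.inr (neg_nonpos.2 ENNReal.toReal_nonneg)

/-- The control of the DECuSum test. -/
noncomputable def decusumControl {L : ℝ → ℝ} (hL : Measurable L) (μ : ℝ) (h : ℝ≥0∞) :
    Control where
  adv := fun w x => truncBelow h (w + L x)
  skip := fun w => min (w + μ) 0
  measurable_adv := (measurable_truncBelow h).comp (measurable_fst.add (hL.comp measurable_snd))
  measurable_skip := (measurable_id.add_const μ).min measurable_const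

lemma decusumStat_eq_state {L : ℝ → ℝ} (hL : Measurable L) (μ : ℝ) (h : ℝ≥0∞) (x : ℕ → ℝ) (n : ℕ) :
    decusumStat L μ h x n = (decusumControl hL μ h).state n 0 (tail x) := by
  induction n with
  | zero => rfl
  | succ n ih => rw [Control.state_succ, decusumStat, ih]; rfl

lemma usedSum_succ (s : ℕ → ℝ) (L : ℝ → ℝ) (x : ℕ → ℝ) {k n : ℕ} (hk : k ≤ n + 1) (a : ℝ) :
    usedSum (Function.update s (n + 1) a) L x k (n + 1) = usedSum s L x k n + a * L (x (n + 1)) := by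
  unfold usedSum
  rw [Finset.sum_Icc_succ_top hk, Function.update_self]
  congr 1
  refine Finset.sum_congr rfl fun i hi => ?_
  rw [Function.update_of_ne (by have := (Finset.mem_Icc.1 hi).2; omega)]

lemma usedSum_empty (s : ℕ → ℝ) (L : ℝ → ℝ) (x : ℕ → ℝ) (n : ℕ) : usedSum s L x (n + 1) n = 0 := by
  simp [usedSum]

/-- The maximum over starting points in the GDECuSum control is the recursively computed CuSum
statistic: the two statistics `W` agree on every path. Besides this, the induction carries that the
maximum `M` of the partial sums satisfies `M ≤ max W 0`, with `M = W` unless `W ≤ 0`. -/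
lemma gdState_spec (L : ℝ → ℝ) (μ : ℝ) (h : ℝ≥0∞) (x : ℕ → ℝ) (n : ℕ) :
    (gdState L μ h x n).1 = decusumStat L μ h x n ∧
    (∀ i, 1 ≤ i → i ≤ n →
      (gdState L μ h x n).2 i = if 0 ≤ decusumStat L μ h x (i - 1) then 1 else 0) ∧
    (∀ k, 1 ≤ k → k ≤ n →
      usedSum (gdState L μ h x n).2 L x k n ≤ max (decusumStat L μ h x n) 0) ∧
    (decusumStat L μ h x n ≤ 0 ∨ ∃ k, 1 ≤ k ∧ k ≤ n ∧
      usedSum (gdState L μ h x n).2 L x k n = decusumStat L μ h x n) := by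
  induction n with
  | zero => exact ⟨rfl, fun i h1 h2 => by omega, fun k h1 h2 => by omega, Or.inl le_rfl⟩
  | succ n ih =>
    obtain ⟨ih1, ih2, ih3, ih4⟩ := ih
    set s := (gdState L μ h x n).2 with hs
    set W := decusumStat L μ h x n with hW
    by_cases hw : 0 ≤ W
    · have hst2 : (gdState L μ h x (n + 1)).2 = Function.update s (n + 1) 1 := by
        rw [gdState, ih1]; simp [hw, hs]
      have hst1 : (gdState L μ h x (n + 1)).1
          = truncBelow h ((Finset.Icc 1 (n + 1)).sup' ⟨1, by simp⟩
            (fun k => usedSum (Function.update s (n + 1) 1) L x k (n + 1))) := by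
        rw [gdState, ih1]; simp [hw, hs]
      have hde : decusumStat L μ h x (n + 1) = truncBelow h (W + L (x (n + 1))) := by
        rw [decusumStat, ← hW, if_pos hw]
      rw [max_eq_left hw] at ih3
      have hub : ∀ k, 1 ≤ k → k ≤ n + 1 →
          usedSum (Function.update s (n + 1) 1) L x k (n + 1) ≤ W + L (x (n + 1)) := by
        intro k hk1 hk2
        rw [usedSum_succ s L x hk2, one_mul]
        rcases Nat.lt_or_ge n k with hk | hk
        · obtain rfl : k = n + 1 := by omega
          rw [usedSum_empty]; linarith
        · linarith [ih3 k hk1 hk]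
      have hatt : ∃ k, 1 ≤ k ∧ k ≤ n + 1 ∧
          usedSum (Function.update s (n + 1) 1) L x k (n + 1) = W + L (x (n + 1)) := by
        rcases ih4 with h0 | ⟨k, hk1, hk2, hk3⟩
        · refine ⟨n + 1, by omega, le_rfl, ?_⟩
          rw [usedSum_succ s L x le_rfl, usedSum_empty, one_mul, le_antisymm h0 hw]
        · exact ⟨k, hk1, by omega, by rw [usedSum_succ s L x (by omega), hk3, one_mul]⟩
      have hsup : (Finset.Icc 1 (n + 1)).sup' ⟨1, by simp⟩
          (fun k => usedSum (Function.update s (n + 1) 1) L x k (n + 1)) = W + L (x (n + 1)) := by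
        refine le_antisymm (Finset.sup'_le _ _ fun k hk => ?_) ?_
        · exact hub k (Finset.mem_Icc.1 hk).1 (Finset.mem_Icc.1 hk).2
        · obtain ⟨k, hk1, hk2, hk3⟩ := hatt
          rw [← hk3]
          exact Finset.le_sup' (fun k => usedSum (Function.update s (n + 1) 1) L x k (n + 1))
            (Finset.mem_Icc.2 ⟨hk1, hk2⟩)
      refine ⟨by rw [hst1, hsup, hde], ?_, ?_, ?_⟩
      · intro i hi1 hi2
        rw [hst2]
        rcases Nat.lt_or_ge n i with hi | hi
        · obtain rfl : i = n + 1 := by omega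
          simp [← hW, hw]
        · rw [Function.update_of_ne (by omega), ih2 i hi1 hi]
      · intro k hk1 hk2
        rw [hst2, hde]
        exact (hub k hk1 hk2).trans ((le_truncBelow h _).trans (le_max_left _ _))
      · rw [hst2, hde]
        rcases truncBelow_eq_or h (W + L (x (n + 1))) with ht | ht
        · rw [ht]; exact Or.inr hatt
        · exact Or.inl ht
    · have hst2 : (gdState L μ h x (n + 1)).2 = Function.update s (n + 1) 0 := by
        rw [gdState, ih1]; simp [hw, hs]
      have hst1 : (gdState L μ h x (n + 1)).1 = min 0 (W + μ) := by
        rw [gdState, ih1]; simp [hw]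
      have hde : decusumStat L μ h x (n + 1) = min (W + μ) 0 := by
        rw [decusumStat, ← hW, if_neg hw]
      rw [max_eq_right (not_le.1 hw).le] at ih3
      refine ⟨by rw [hst1, hde, min_comm], ?_, ?_, ?_⟩
      · intro i hi1 hi2
        rw [hst2]
        rcases Nat.lt_or_ge n i with hi | hi
        · obtain rfl : i = n + 1 := by omega
          simp [← hW, hw]
        · rw [Function.update_of_ne (by omega), ih2 i hi1 hi]
      · intro k hk1 hk2
        rw [hst2, usedSum_succ s L x hk2, zero_mul, add_zero]
        refine le_trans ?_ (le_max_right _ _)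
        rcases Nat.lt_or_ge n k with hk | hk
        · obtain rfl : k = n + 1 := by omega
          rw [usedSum_empty]
        · exact ih3 k hk1 hk
      · rw [hde]; exact Or.inl (min_le_right _ _)

lemma gdControl_eq {L : ℝ → ℝ} (μ : ℝ) (h : ℝ≥0∞) (x : ℕ → ℝ) {n : ℕ} (hn : 1 ≤ n) :
    gdControl L μ h n x = if 0 ≤ decusumStat L μ h x (n - 1) then 1 else 0 :=
  (gdState_spec L μ h x n).2.1 n hn le_rfl

lemma gdControl_eq_used {L : ℝ → ℝ} (hL : Measurable L) (μ : ℝ) (h : ℝ≥0∞) (x : ℕ → ℝ) {n : ℕ}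
    (hn : 1 ≤ n) : gdControl L μ h n x = (decusumControl hL μ h).used x n := by
  rw [gdControl_eq μ h x hn, decusumStat_eq_state hL]; rfl

lemma pdc_gdecusum (ν : Measure ℝ) (f₀ : ℝ → ℝ) (f : ℝ → ℝ → ℝ) (Θ : Set ℝ) (θs μ : ℝ) (h : ℝ≥0∞)
    (A : ℝ) : PDC ν f₀ (gdecusum f₀ f Θ θs μ h A) = PDC ν f₀ (decusum f₀ (f θs) μ h A) := by
  unfold PDC
  congr 1
  funext γ
  refine lintegral_congr fun x => ?_
  congr 2
  exact Finset.sum_congr rfl fun n hn => gdControl_eq μ h x (Finset.mem_Ico.1 hn).1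

lemma gdecusum_tau_eq {f₀ : ℝ → ℝ} {f : ℝ → ℝ → ℝ} {θs : ℝ} (hL : Measurable (llr f₀ (f θs)))
    (Θ : Set ℝ) (μ : ℝ) (h : ℝ≥0∞) (A : ℝ) (x : ℕ → ℝ) :
    (gdecusum f₀ f Θ θs μ h A).τ x
      = firstPassage (glrStat f₀ f Θ ((decusumControl hL μ h).used x) x) A :=
  firstPassage_congr fun _ _ =>
    glrStat_congr (fun _ hi => gdControl_eq_used hL μ h x hi) fun _ _ => rfl

lemma gcusum_tau_eq (f₀ : ℝ → ℝ) (f : ℝ → ℝ → ℝ) (Θ : Set ℝ) (A : ℝ) (x : ℕ → ℝ) :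
    (gcusum f₀ f Θ A).τ x = firstPassage (glrStat f₀ f Θ (alwaysUse.used x) x) A := by
  rw [used_alwaysUse]; rfl

/-! ### The duration of the skipping phases -/

/-- Convexity of the exponential on the segment from `0` to `y`. -/
lemma exp_mul_le {p : ℝ} (hp0 : 0 ≤ p) (hp1 : p ≤ 1) (y : ℝ) :
    Real.exp (p * y) ≤ p * Real.exp y + (1 - p) := by
  have := convexOn_exp.2 (Set.mem_univ y) (Set.mem_univ 0) hp0 (sub_nonneg.2 hp1) (by ring)
  simpa using this

/-- A variable with positive mean and a finite negative exponential moment has an exponential moment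
of small negative order below `1`: the derivative of the moment generating function at `0` is the
mean. -/
lemma exists_integral_exp_neg_lt_one {P : Measure ℝ} [IsProbabilityMeasure P] {L : ℝ → ℝ}
    (hLm : Measurable L) (hLi : Integrable L P) (hLpos : 0 < ∫ x, L x ∂P) {t₀ : ℝ} (ht₀ : 0 < t₀)
    (he : Integrable (fun x => Real.exp (-(t₀ * L x))) P) :
    ∃ t, 0 < t ∧ Integrable (fun x => Real.exp (-(t * L x))) P ∧
      ∫ x, Real.exp (-(t * L x)) ∂P < 1 := by
  set t : ℕ → ℝ := fun n => t₀ / (n + 1) with ht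
  have htpos : ∀ n, 0 < t n := fun n => by positivity
  have hle : ∀ n, t n ≤ t₀ := fun n =>
    div_le_self ht₀.le (by have : (0 : ℝ) ≤ n := Nat.cast_nonneg n; linarith)
  have hconv : ∀ n x, Real.exp (-(t n * L x))
      ≤ t n / t₀ * Real.exp (-(t₀ * L x)) + (1 - t n / t₀) := by
    intro n x
    have := exp_mul_le (div_nonneg (htpos n).le ht₀.le) ((div_le_one ht₀).2 (hle n)) (-(t₀ * L x))
    rwa [show t n / t₀ * -(t₀ * L x) = -(t n * L x) by field_simp] at this
  have hmeas : ∀ n, Measurable fun x => Real.exp (-(t n * L x)) := fun n => by fun_prop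
  have hint : ∀ n, Integrable (fun x => Real.exp (-(t n * L x))) P := by
    intro n
    refine ((he.const_mul (t n / t₀)).add (integrable_const (1 - t n / t₀))).mono'
      (hmeas n).aestronglyMeasurable (Eventually.of_forall fun x => ?_)
    rw [Real.norm_of_nonneg (Real.exp_pos _).le]
    exact hconv n x
  have hlim : Tendsto (fun n => ∫ x, (1 - Real.exp (-(t n * L x))) / t n ∂P) atTop
      (𝓝 (∫ x, L x ∂P)) := by
    refine tendsto_integral_of_dominated_convergence
      (fun x => |L x| + Real.exp (-(t₀ * L x)) / t₀)
      (fun n => ((measurable_const.sub (hmeas n)).div_const _).aestronglyMeasurable)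
      (hLi.abs.add (he.div_const t₀)) (fun n => Eventually.of_forall fun x => ?_)
      (Eventually.of_forall fun x => ?_)
    · rw [Real.norm_eq_abs, abs_le]
      have hE := Real.exp_pos (-(t₀ * L x))
      constructor
      · rw [le_div_iff₀ (htpos n)]
        have h1 := hconv n x
        have h2 : (|L x| + Real.exp (-(t₀ * L x)) / t₀) * t n
            = |L x| * t n + t n / t₀ * Real.exp (-(t₀ * L x)) := by ring
        have h3 : 0 ≤ |L x| * t n := mul_nonneg (abs_nonneg _) (htpos n).le
        have h4 : 0 ≤ t n / t₀ := div_nonneg (htpos n).le ht₀.le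
        linarith
      · rw [div_le_iff₀ (htpos n)]
        have h1 := Real.add_one_le_exp (-(t n * L x))
        have h2 : L x * t n ≤ |L x| * t n := mul_le_mul_of_nonneg_right (le_abs_self _) (htpos n).le
        have h3 : 0 ≤ Real.exp (-(t₀ * L x)) / t₀ * t n := by
          have := (htpos n).le; positivity
        linarith
    · have ht0 : Tendsto t atTop (𝓝[≠] 0) := by
        refine tendsto_nhdsWithin_iff.2 ⟨?_, Eventually.of_forall fun n => (htpos n).ne'⟩
        exact tendsto_const_div_atTop_nhds_zero_nat t₀ |>.comp (tendsto_add_atTop_nat 1)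
          |>.congr fun n => by simp [ht]
      have hder : HasDerivAt (fun s => -Real.exp (-(s * L x))) (L x) 0 := by
        have h1 : HasDerivAt (fun s : ℝ => -(s * L x)) (-(1 * L x)) 0 :=
          ((hasDerivAt_id (0 : ℝ)).mul_const (L x)).neg
        refine h1.exp.neg.congr_deriv ?_
        simp
      have := (hasDerivAt_iff_tendsto_slope_zero.1 hder).comp ht0
      refine this.congr fun n => ?_
      simp only [Function.comp_apply, zero_add, zero_mul, neg_zero, Real.exp_zero, smul_eq_mul]
      field_simp
      ring
  obtain ⟨n, hn⟩ := (hlim.eventually (lt_mem_nhds hLpos)).exists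
  refine ⟨t n, htpos n, hint n, ?_⟩
  rw [integral_div, integral_sub (integrable_const 1) (hint n)] at hn
  have := (div_pos_iff_of_pos_right (htpos n)).1 hn
  simp at this
  linarith

/-- If the increment `L` has a negative exponential moment `r < 1`, then the mean number of
observations that the DECuSum control skips is bounded. The potential is `q e^{-t w}` at `w ≥ 0`;
below zero it is the remaining length of the skipping phase, at most `K = h / μ + 1`, plus `q`.
The supermartingale inequality at `w ≥ 0` reads `(q + K) r ≤ q`, whence `q = K r / (1 - r)`. -/
lemma exists_potential {P : Measure ℝ} [IsProbabilityMeasure P] {L : ℝ → ℝ} (hLm : Measurable L)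
    {t : ℝ} (ht : 0 < t) (hi : Integrable (fun x => Real.exp (-(t * L x))) P)
    (hr : ∫ x, Real.exp (-(t * L x)) ∂P < 1) {μ : ℝ} (hμ : 0 < μ) {h : ℝ≥0∞} (hh : h < ∞) :
    ∃ (V : ℝ → ℝ) (B : ℝ), (∀ w, 0 ≤ V w) ∧
      (∀ w, 0 ≤ w → Integrable (fun x => V ((decusumControl hLm μ h).adv w x)) P) ∧
      (∀ w, 0 ≤ w → ∫ x, V ((decusumControl hLm μ h).adv w x) ∂P ≤ V w) ∧
      (∀ w, w < 0 → 1 + V ((decusumControl hLm μ h).skip w) ≤ V w) ∧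
      ∀ n x, V ((decusumControl hLm μ h).state n 0 x) ≤ B := by
  set r := ∫ x, Real.exp (-(t * L x)) ∂P with hrdef
  have hr0 : 0 ≤ r := integral_nonneg fun x => (Real.exp_pos _).le
  set H := h.toReal with hH
  have hH0 : 0 ≤ H := ENNReal.toReal_nonneg
  set K := H / μ + 1 with hK
  have hK0 : 0 < K := by positivity
  set q := K * r / (1 - r) with hq
  have hq0 : 0 ≤ q := div_nonneg (mul_nonneg hK0.le hr0) (by linarith)
  have hqK : (q + K) * r = q := by
    have : (1 - r) ≠ 0 := by linarith
    rw [hq]; field_simp; ring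
  set V : ℝ → ℝ := fun w => if 0 ≤ w then q * Real.exp (-(t * w)) else -w / μ + 1 + q with hV
  have hVm : Measurable V := by
    refine Measurable.ite (measurableSet_le measurable_const measurable_id) ?_ ?_ <;> fun_prop
  have hV0 : ∀ w, 0 ≤ V w := by
    intro w
    simp only [hV]
    split_ifs with hw
    · exact mul_nonneg hq0 (Real.exp_pos _).le
    · have : 0 ≤ -w / μ := div_nonneg (by linarith) hμ.le
      linarith
  have htr : ∀ y, truncBelow h y = max y (-H) := fun y => if_neg hh.ne
  have hbd : ∀ w x, V ((decusumControl hLm μ h).adv w x)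
      ≤ (q + K) * Real.exp (-(t * w)) * Real.exp (-(t * L x)) := by
    intro w x
    have hadv : (decusumControl hLm μ h).adv w x = max (w + L x) (-H) := htr _
    rw [hadv, mul_assoc, ← Real.exp_add]
    have he : -(t * w) + -(t * L x) = -(t * (w + L x)) := by ring
    rw [he]
    simp only [hV]
    split_ifs with hw
    · refine mul_le_mul (by linarith) (Real.exp_le_exp.2 (neg_le_neg ?_)) (Real.exp_pos _).le
        (by linarith)
      exact mul_le_mul_of_nonneg_left (le_max_left _ _) ht.le
    · have hlt := not_le.1 hw
      have h1 : w + L x < 0 := (le_max_left _ _).trans_lt hlt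
      have h2 : -H ≤ max (w + L x) (-H) := le_max_right _ _
      have h3 : -max (w + L x) (-H) / μ ≤ H / μ := by gcongr; linarith
      have h4 : 1 ≤ Real.exp (-(t * (w + L x))) :=
        Real.one_le_exp (by nlinarith)
      nlinarith
  have hVint : ∀ w, Integrable (fun x => V ((decusumControl hLm μ h).adv w x)) P := by
    intro w
    refine (hi.const_mul ((q + K) * Real.exp (-(t * w)))).mono' ?_
      (Eventually.of_forall fun x => ?_)
    · exact (hVm.comp ((decusumControl hLm μ h).measurable_adv.comp
        (measurable_const.prodMk measurable_id))).aestronglyMeasurable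
    · rw [Real.norm_of_nonneg (hV0 _)]
      exact hbd w x
  have hst : ∀ n x, -H ≤ (decusumControl hLm μ h).state n 0 x := by
    intro n x
    induction n with
    | zero => simpa [Control.state] using hH0
    | succ n ih =>
      rw [Control.state_succ, Control.step]
      split_ifs
      · exact (le_max_right _ _).trans_eq (htr _).symm
      · exact le_min (ih.trans (le_add_of_nonneg_right hμ.le)) (by linarith)
  refine ⟨V, q + K, hV0, fun w _ => hVint w, fun w hw => ?_, fun w hw => ?_, fun n x => ?_⟩
  · refine (integral_mono (hVint w) (hi.const_mul _) (hbd w)).trans ?_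
    rw [integral_const_mul, ← hrdef, mul_right_comm, hqK]
    simp [hV, hw]
  · have hsk : (decusumControl hLm μ h).skip w = min (w + μ) 0 := rfl
    have hVw : V w = -w / μ + 1 + q := by simp [hV, not_le.2 hw]
    rw [hsk, hVw]
    rcases le_or_gt 0 (w + μ) with h1 | h1
    · rw [min_eq_right h1]
      have : 0 ≤ -w / μ := div_nonneg (by linarith) hμ.le
      simp [hV]
      linarith
    · rw [min_eq_left h1.le]
      simp only [hV, not_le.2 h1, if_false]
      have : -(w + μ) / μ = -w / μ - 1 := by field_simp; ring
      rw [this]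
      linarith
  · have h1 := hst n x
    simp only [hV]
    split_ifs with hw
    · have : Real.exp (-(t * (decusumControl hLm μ h).state n 0 x)) ≤ 1 :=
        Real.exp_le_one_iff.2 (by nlinarith)
      nlinarith
    · have : -(decusumControl hLm μ h).state n 0 x / μ ≤ H / μ := by gcongr; linarith
      linarith

/-! ### Exponential families -/

/-- The densities `f θ`, `θ ∈ Θ`, are those of the exponential family generated by `f₀`, with
cumulant function `b`. -/
structure IsExpFamily (ν : Measure ℝ) (f₀ : ℝ → ℝ) (f : ℝ → ℝ → ℝ) (b : ℝ → ℝ) (Θ : Set ℝ) :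
    Prop where
  pdf₀ : IsPDF ν f₀
  pdf : ∀ θ ∈ Θ, IsPDF ν (f θ)
  exp_eq : ∀ θ ∈ Θ, ∀ x, f θ x = Real.exp (θ * x - b θ) * f₀ x

lemma measurable_llr {ν : Measure ℝ} {f₀ g : ℝ → ℝ} (hf₀ : IsPDF ν f₀) (hg : IsPDF ν g) :
    Measurable (llr f₀ g) :=
  Real.measurable_log.comp (hg.1.div hf₀.1)

lemma ae_obsLaw_ne_zero {ν : Measure ℝ} {g : ℝ → ℝ} (hg : IsPDF ν g) :
    ∀ᵐ x ∂(obsLaw ν g), g x ≠ 0 := by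
  rw [obsLaw, ae_withDensity_iff hg.1.ennreal_ofReal]
  refine Eventually.of_forall fun x hx h0 => hx ?_
  rw [h0, ENNReal.ofReal_zero]

lemma integrable_exp_of_lintegral {P : Measure ℝ} {φ : ℝ → ℝ} (hφ : Measurable φ)
    (h : ∫⁻ x, ENNReal.ofReal (Real.exp (φ x)) ∂P ≠ ∞) :
    Integrable (fun x => Real.exp (φ x)) P := by
  refine ⟨hφ.exp.aestronglyMeasurable, ?_⟩
  rw [hasFiniteIntegral_iff_ofReal (Eventually.of_forall fun x => (Real.exp_pos _).le)]
  exact h.lt_top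

lemma integral_exp_eq {P : Measure ℝ} {φ : ℝ → ℝ} (hφ : Measurable φ) :
    ∫ x, Real.exp (φ x) ∂P = (∫⁻ x, ENNReal.ofReal (Real.exp (φ x)) ∂P).toReal :=
  integral_eq_lintegral_of_nonneg_ae (Eventually.of_forall fun _ => (Real.exp_pos _).le)
    hφ.exp.aestronglyMeasurable

namespace IsExpFamily

variable {ν : Measure ℝ} {f₀ : ℝ → ℝ} {f : ℝ → ℝ → ℝ} {b : ℝ → ℝ} {Θ : Set ℝ} {θ θ' : ℝ}

lemma obsLaw_eq (hE : IsExpFamily ν f₀ f b Θ) (hθ : θ ∈ Θ) :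
    obsLaw ν (f θ) = (obsLaw ν f₀).withDensity
      fun x => ENNReal.ofReal (Real.exp (θ * x - b θ)) := by
  rw [obsLaw, obsLaw, ← withDensity_mul _ hE.pdf₀.1.ennreal_ofReal (by fun_prop)]
  congr 1
  funext x
  rw [Pi.mul_apply, hE.exp_eq θ hθ, mul_comm, ENNReal.ofReal_mul (hE.pdf₀.2.1 x)]

lemma absolutelyContinuous (hE : IsExpFamily ν f₀ f b Θ) (hθ : θ ∈ Θ) :
    obsLaw ν (f θ) ≪ obsLaw ν f₀ := by
  rw [hE.obsLaw_eq hθ]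
  exact withDensity_absolutelyContinuous _ _

lemma ae_ne_zero (hE : IsExpFamily ν f₀ f b Θ) (hθ : θ ∈ Θ) :
    ∀ᵐ x ∂(obsLaw ν (f θ)), f₀ x ≠ 0 :=
  (hE.absolutelyContinuous hθ).ae_le (ae_obsLaw_ne_zero hE.pdf₀)

lemma llr_eq (hE : IsExpFamily ν f₀ f b Θ) (hθ : θ ∈ Θ) {x : ℝ} (hx : f₀ x ≠ 0) :
    llr f₀ (f θ) x = θ * x - b θ := by
  rw [llr, hE.exp_eq θ hθ, mul_div_assoc, div_self hx, mul_one, Real.log_exp]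

/-- At a zero of `f₀` the log-likelihood ratio is `log (0 / 0) = 0`. -/
lemma llr_eq_indicator (hE : IsExpFamily ν f₀ f b Θ) (hθ : θ ∈ Θ) (x : ℝ) :
    llr f₀ (f θ) x
      = θ * (if f₀ x = 0 then 0 else x) - b θ * (if f₀ x = 0 then 0 else 1) := by
  by_cases hx : f₀ x = 0
  · simp [llr, hx]
  · simp [hE.llr_eq hθ hx, hx]

lemma lintegral_obsLaw (hE : IsExpFamily ν f₀ f b Θ) (hθ : θ ∈ Θ) {F : ℝ → ℝ≥0∞}
    (hF : Measurable F) : ∫⁻ x, F x ∂(obsLaw ν (f θ))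
      = ∫⁻ x, ENNReal.ofReal (Real.exp (θ * x - b θ)) * F x ∂(obsLaw ν f₀) := by
  rw [hE.obsLaw_eq hθ, lintegral_withDensity_eq_lintegral_mul _ (by fun_prop) hF]
  rfl

lemma lintegral_exp (hE : IsExpFamily ν f₀ f b Θ) (hθ : θ ∈ Θ) :
    ∫⁻ x, ENNReal.ofReal (Real.exp (θ * x - b θ)) ∂(obsLaw ν f₀) = 1 := by
  have := isProbabilityMeasure_obsLaw (hE.pdf θ hθ)
  have h := hE.lintegral_obsLaw hθ (F := fun _ => 1) measurable_const
  simpa using h.symm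

/-- Change of the parameter inside the family. -/
lemma lintegral_exp_sub (hE : IsExpFamily ν f₀ f b Θ) (hθ : θ ∈ Θ) (hθ' : θ' ∈ Θ) :
    ∫⁻ x, ENNReal.ofReal (Real.exp ((θ' * x - b θ') - (θ * x - b θ))) ∂(obsLaw ν (f θ)) = 1 := by
  rw [hE.lintegral_obsLaw hθ (by fun_prop), ← hE.lintegral_exp hθ']
  refine lintegral_congr fun x => ?_
  rw [← ENNReal.ofReal_mul (Real.exp_pos _).le, ← Real.exp_add]
  congr 2
  ring

lemma integrable_id (hE : IsExpFamily ν f₀ f b Θ) (hθ : θ ∈ Θ) (hθ0 : θ ≠ 0)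
    (hi : Integrable (llr f₀ (f θ)) (obsLaw ν (f θ))) :
    Integrable (fun x : ℝ => x) (obsLaw ν (f θ)) := by
  have := isProbabilityMeasure_obsLaw (hE.pdf θ hθ)
  refine ((hi.add (integrable_const (b θ))).div_const θ).congr ?_
  filter_upwards [hE.ae_ne_zero hθ] with x hx
  simp only [Pi.add_apply, hE.llr_eq hθ hx]
  field_simp
  ring

lemma integral_llr (hE : IsExpFamily ν f₀ f b Θ) (hθ : θ ∈ Θ) (hθ' : θ' ∈ Θ)
    (hi : Integrable (fun x : ℝ => x) (obsLaw ν (f θ))) :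
    ∫ x, llr f₀ (f θ') x ∂(obsLaw ν (f θ)) = θ' * ∫ x, x ∂(obsLaw ν (f θ)) - b θ' := by
  have := isProbabilityMeasure_obsLaw (hE.pdf θ hθ)
  have h1 : ∫ x, llr f₀ (f θ') x ∂(obsLaw ν (f θ)) = ∫ x, (θ' * x - b θ') ∂(obsLaw ν (f θ)) := by
    refine integral_congr_ae ?_
    filter_upwards [hE.ae_ne_zero hθ] with x hx using hE.llr_eq hθ' hx
  rw [h1, integral_sub (hi.const_mul θ') (integrable_const _), integral_const_mul]
  simp

/-- Gibbs' inequality: under `f θ`, the mean log-likelihood ratio is largest at `θ`. -/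
lemma mean_llr_le (hE : IsExpFamily ν f₀ f b Θ) (hθ : θ ∈ Θ) (hθ' : θ' ∈ Θ)
    (hi : Integrable (fun x : ℝ => x) (obsLaw ν (f θ))) :
    θ' * ∫ x, x ∂(obsLaw ν (f θ)) - b θ' ≤ divPost ν f₀ (f θ) := by
  have := isProbabilityMeasure_obsLaw (hE.pdf θ hθ)
  rw [divPost, hE.integral_llr hθ hθ hi]
  have h1 := hE.lintegral_exp_sub hθ hθ'
  set φ : ℝ → ℝ := fun x => (θ' * x - b θ') - (θ * x - b θ) with hφ
  have hφm : Measurable φ := by fun_prop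
  have hei : Integrable (fun x => Real.exp (φ x)) (obsLaw ν (f θ)) :=
    integrable_exp_of_lintegral hφm (by rw [h1]; exact ENNReal.one_ne_top)
  have he : ∫ x, Real.exp (φ x) ∂(obsLaw ν (f θ)) = 1 := by
    rw [integral_exp_eq hφm, h1, ENNReal.toReal_one]
  have hi' : Integrable (fun x => θ' * x - b θ') (obsLaw ν (f θ)) :=
    (hi.const_mul θ').sub (integrable_const _)
  have hi'' : Integrable (fun x => θ * x - b θ) (obsLaw ν (f θ)) :=
    (hi.const_mul θ).sub (integrable_const _)
  have h2 : ∫ x, φ x ∂(obsLaw ν (f θ)) ≤ ∫ x, (Real.exp (φ x) - 1) ∂(obsLaw ν (f θ)) :=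
    integral_mono (hi'.sub hi'') (hei.sub (integrable_const 1)) fun x => by
      have := Real.add_one_le_exp (φ x)
      simp only
      linarith
  rw [integral_sub hei (integrable_const 1), he, hφ, integral_sub hi' hi'',
    integral_sub (hi.const_mul θ') (integrable_const _),
    integral_sub (hi.const_mul θ) (integrable_const _), integral_const_mul,
    integral_const_mul] at h2
  simp at h2
  linarith

/-- For a fixed starting point, the statistic is a supremum of continuous functions of the sum and
of the number of the observations, hence lower semicontinuous in these. -/
lemma measurable_glrStat (hE : IsExpFamily ν f₀ f b Θ) (n : ℕ) :
    Measurable fun x : ℕ → ℝ => glrStat f₀ f Θ (fun _ => 1) x n := by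
  have hind : Measurable fun x : ℝ => if f₀ x = 0 then (0 : ℝ) else 1 :=
    Measurable.ite (hE.pdf₀.1 (measurableSet_singleton 0)) measurable_const measurable_const
  have hx : Measurable fun x : ℝ => if f₀ x = 0 then (0 : ℝ) else x :=
    Measurable.ite (hE.pdf₀.1 (measurableSet_singleton 0)) measurable_const measurable_id
  set G : ℝ × ℝ → EReal := fun p => ⨆ θ ∈ Θ, ((θ * p.2 - b θ * p.1 : ℝ) : EReal) with hG
  have hGm : Measurable G := by
    refine LowerSemicontinuous.measurable (lowerSemicontinuous_biSup fun θ _ => ?_)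
    exact (continuous_coe_real_ereal.comp (by fun_prop)).lowerSemicontinuous
  have hsum : ∀ k, (fun x : ℕ → ℝ => ⨆ θ ∈ Θ,
      ((usedSum (fun _ => 1) (llr f₀ (f θ)) x k n : ℝ) : EReal)) = fun x =>
        G (∑ i ∈ Finset.Icc k n, (if f₀ (x i) = 0 then (0 : ℝ) else 1),
          ∑ i ∈ Finset.Icc k n, if f₀ (x i) = 0 then (0 : ℝ) else x i) := by
    intro k
    funext x
    refine iSup_congr fun θ => iSup_congr fun hθ => ?_
    congr 1
    rw [usedSum, Finset.mul_sum, Finset.mul_sum, ← Finset.sum_sub_distrib]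
    refine Finset.sum_congr rfl fun i _ => ?_
    rw [one_mul, hE.llr_eq_indicator hθ]
  unfold glrStat
  refine Measurable.iSup fun k => Measurable.iSup fun _ => ?_
  rw [hsum k]
  refine hGm.comp (Measurable.prodMk ?_ ?_)
  · exact Finset.measurable_sum _ fun i _ => hind.comp (measurable_pi_apply i)
  · exact Finset.measurable_sum _ fun i _ => hx.comp (measurable_pi_apply i)

lemma measurable_firstPassage (hE : IsExpFamily ν f₀ f b Θ) (A : ℝ) :
    Measurable fun x : ℕ → ℝ => firstPassage (glrStat f₀ f Θ (fun _ => 1) x) A := by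
  refine measurable_to_countable' fun t => ?_
  have hle : ∀ n : ℕ, MeasurableSet
      {x : ℕ → ℝ | firstPassage (glrStat f₀ f Θ (fun _ => 1) x) A ≤ n} := by
    intro n
    simp only [firstPassage_le_iff]
    have : {x : ℕ → ℝ | ∃ m, 1 ≤ m ∧ m ≤ n ∧ (A : EReal) ≤ glrStat f₀ f Θ (fun _ => 1) x m}
        = ⋃ m, ⋃ (_ : 1 ≤ m ∧ m ≤ n), {x | (A : EReal) ≤ glrStat f₀ f Θ (fun _ => 1) x m} := by
      ext x; simp [and_assoc]
    rw [this]
    exact MeasurableSet.iUnion fun m => MeasurableSet.iUnion fun _ =>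
      measurableSet_le measurable_const (hE.measurable_glrStat m)
  have hlt : ∀ n : ℕ, MeasurableSet
      {x : ℕ → ℝ | firstPassage (glrStat f₀ f Θ (fun _ => 1) x) A < n} := by
    intro n
    cases n with
    | zero => simp
    | succ n =>
      convert! hle n using 3 with x
      push_cast
      exact ENat.lt_add_one_iff (ENat.natCast_ne_top n)
  induction t using ENat.recTopCoe with
  | top =>
    have : (fun x : ℕ → ℝ => firstPassage (glrStat f₀ f Θ (fun _ => 1) x) A) ⁻¹' {⊤}
        = ⋂ n : ℕ, {x | firstPassage (glrStat f₀ f Θ (fun _ => 1) x) A < n}ᶜ := by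
      ext x
      simp [ENat.eq_top_iff_forall_ge]
    rw [this]
    exact MeasurableSet.iInter fun n => (hlt n).compl
  | coe n =>
    have : (fun x : ℕ → ℝ => firstPassage (glrStat f₀ f Θ (fun _ => 1) x) A) ⁻¹' {(n : ℕ∞)}
        = {x | firstPassage (glrStat f₀ f Θ (fun _ => 1) x) A ≤ n} \
          {x | firstPassage (glrStat f₀ f Θ (fun _ => 1) x) A < n} := by
      ext x
      simp [le_antisymm_iff]
    rw [this]
    exact (hle n).diff (hlt n)

end IsExpFamily

/-! ### Lower bound for the detection delay -/

lemma sum_Icc_cons (y : ℕ → ℝ) (a : ℝ) {k n : ℕ} (hk : k ≤ n) :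
    ∑ i ∈ Finset.Icc (k + 1) n, cons a y i
      = ∑ i ∈ Finset.range n, y i - ∑ i ∈ Finset.range k, y i := by
  rw [← Finset.sum_Ico_eq_sub _ hk]
  induction n, hk using Nat.le_induction with
  | base => simp
  | succ n hk ih =>
    rw [Finset.sum_Icc_succ_top (by omega), ih, Finset.sum_Ico_succ_top hk, cons_succ]

/-- The finitely many `n` at which `S n / n` is not yet within `η` of its limit are absorbed by a
constant. -/
lemma exists_abs_sub_le {S : ℕ → ℝ} {m η : ℝ} (hη : 0 < η)
    (h : Tendsto (fun n : ℕ => S n / n) atTop (𝓝 m)) :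
    ∃ K : ℕ, ∀ n : ℕ, |S n - n * m| ≤ K + η * n := by
  obtain ⟨N, hN⟩ := (Metric.tendsto_atTop.1 h) η hη
  obtain ⟨K, hK⟩ := exists_nat_ge (∑ i ∈ Finset.range (N + 1), |S i - i * m|)
  refine ⟨K, fun n => ?_⟩
  have hn0 : 0 ≤ η * n := by positivity
  rcases le_or_gt n N with hn | hn
  · have := Finset.single_le_sum (f := fun i : ℕ => |S i - i * m|) (fun i _ => abs_nonneg _)
      (Finset.mem_range.2 (Nat.lt_succ_of_le hn))
    linarith
  · have hnpos : (0 : ℝ) < n := by exact_mod_cast (Nat.zero_le N).trans_lt hn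
    have h1 := hN n hn.le
    rw [Real.dist_eq] at h1
    have h2 : S n - n * m = (S n / n - m) * n := by field_simp
    rw [h2, abs_mul, abs_of_pos hnpos]
    have h3 : |S n / n - m| * n ≤ η * n := mul_le_mul_of_nonneg_right h1.le hnpos.le
    have h4 : (0 : ℝ) ≤ K := Nat.cast_nonneg K
    linarith

namespace IsExpFamily

variable {ν : Measure ℝ} {f₀ : ℝ → ℝ} {f : ℝ → ℝ → ℝ} {b : ℝ → ℝ} {Θ : Set ℝ} {θ θ' : ℝ}

/-- A linear bound for the fluctuations of the random walk makes the detection statistic grow at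
most linearly: for all `θ'` at once, the drift of the log-likelihood ratio is at most `D`, and its
fluctuations are at most `θu` times those of the random walk. -/
lemma glrStat_cons_le (hE : IsExpFamily ν f₀ f b Θ) {θu m D K η : ℝ} (hΘ0 : ∀ θ ∈ Θ, 0 ≤ θ)
    (hΘu : ∀ θ ∈ Θ, θ ≤ θu) (hD : ∀ θ ∈ Θ, θ * m - b θ ≤ D) (hD0 : 0 ≤ D)
    (hη : 0 ≤ η) {y : ℕ → ℝ} (hy : ∀ i, f₀ (y i) ≠ 0)
    (hdev : ∀ n : ℕ, |∑ i ∈ Finset.range n, y i - n * m| ≤ K + η * n) (n : ℕ) :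
    glrStat f₀ f Θ (fun _ => 1) (cons 0 y) n
      ≤ ((2 * θu * K + n * (D + 2 * θu * η) : ℝ) : EReal) := by
  refine iSup₂_le fun k hk => iSup₂_le fun θ hθ => EReal.coe_le_coe_iff.2 ?_
  obtain ⟨hk1, hkn⟩ := Finset.mem_Icc.1 hk
  obtain ⟨k, rfl⟩ : ∃ k', k = k' + 1 := ⟨k - 1, by omega⟩
  have hsum : usedSum (fun _ => 1) (llr f₀ (f θ)) (cons 0 y) (k + 1) n
      = θ * ∑ i ∈ Finset.Icc (k + 1) n, cons 0 y i - (n - k) * b θ := by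
    have h1 : usedSum (fun _ => 1) (llr f₀ (f θ)) (cons 0 y) (k + 1) n
        = ∑ i ∈ Finset.Icc (k + 1) n, (θ * cons 0 y i - b θ) := by
      refine Finset.sum_congr rfl fun i hi => ?_
      obtain ⟨i, rfl⟩ : ∃ i', i = i' + 1 := ⟨i - 1, by have := (Finset.mem_Icc.1 hi).1; omega⟩
      rw [one_mul, cons_succ, hE.llr_eq hθ (hy i)]
    rw [h1, Finset.sum_sub_distrib, Finset.mul_sum]
    congr 1
    simp only [Finset.sum_const, Nat.card_Icc, nsmul_eq_mul]
    rw [show n + 1 - (k + 1) = n - k by omega, Nat.cast_sub (by omega)]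
  rw [hsum, sum_Icc_cons y 0 (by omega)]
  set S := ∑ i ∈ Finset.range n, y i
  set S' := ∑ i ∈ Finset.range k, y i
  have e : θ * (S - S') - (n - k) * b θ
      = θ * ((S - n * m) - (S' - k * m)) + (n - k) * (θ * m - b θ) := by ring
  have hkn' : (k : ℝ) ≤ n := by exact_mod_cast (by omega : k ≤ n)
  have hk0 : (0 : ℝ) ≤ k := Nat.cast_nonneg k
  have hK : 0 ≤ K := by simpa using (abs_nonneg _).trans (hdev 0)
  have hηk : η * k ≤ η * n := mul_le_mul_of_nonneg_left hkn' hη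
  have h1 : (S - n * m) - (S' - k * m) ≤ 2 * K + 2 * η * n := by
    have a1 := (abs_le.1 (hdev n)).2
    have a2 := (abs_le.1 (hdev k)).1
    linarith
  have h2 : θ * ((S - n * m) - (S' - k * m)) ≤ θu * (2 * K + 2 * η * n) := by
    refine (mul_le_mul_of_nonneg_left h1 (hΘ0 θ hθ)).trans
      (mul_le_mul_of_nonneg_right (hΘu θ hθ) ?_)
    have : 0 ≤ η * n := mul_nonneg hη (hk0.trans hkn')
    linarith
  have h3 : (n - k) * (θ * m - b θ) ≤ n * D :=
    (mul_le_mul_of_nonneg_left (hD θ hθ) (by linarith)).trans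
      (mul_le_mul_of_nonneg_right (by linarith) hD0)
  rw [e]
  nlinarith

/-- The mean run length of the GCuSum test under `f θ` is at least about `A / D(f θ ‖ f₀)`. -/
lemma lintegral_firstPassage_ge (hE : IsExpFamily ν f₀ f b Θ) {θu : ℝ} (hΘ0 : ∀ θ ∈ Θ, 0 < θ)
    (hΘu : ∀ θ ∈ Θ, θ ≤ θu) (hθ : θ ∈ Θ)
    (hi : Integrable (llr f₀ (f θ)) (obsLaw ν (f θ))) (hD : 0 < divPost ν f₀ (f θ)) {ε : ℝ}
    (hε : 0 < ε) (hε1 : ε < 1) :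
    ∃ A₀ : ℝ, ∀ A, A₀ ≤ A → ENNReal.ofReal ((1 - ε) * A / divPost ν f₀ (f θ))
      ≤ ∫⁻ y, (firstPassage (glrStat f₀ f Θ (fun _ => 1) (cons 0 y)) A : ℝ≥0∞)
        ∂(iid (obsLaw ν (f θ))) := by
  set ρ := obsLaw ν (f θ) with hρ
  set D := divPost ν f₀ (f θ) with hDdef
  have hρp : IsProbabilityMeasure ρ := isProbabilityMeasure_obsLaw (hE.pdf θ hθ)
  have hθu : 0 < θu := (hΘ0 θ hθ).trans_le (hΘu θ hθ)
  have hid := hE.integrable_id hθ (hΘ0 θ hθ).ne' hi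
  set m := ∫ x, x ∂ρ with hm
  set δ := ε / 3 with hδ
  have hδ0 : 0 < δ := by positivity
  set η := δ * D / (2 * θu) with hη
  have hη0 : 0 < η := by positivity
  -- almost every path is good for some `K`
  set good : ℕ → Set (ℕ → ℝ) := fun K => {y | (∀ i, f₀ (y i) ≠ 0) ∧
    ∀ n : ℕ, |∑ i ∈ Finset.range n, y i - n * m| ≤ K + η * n} with hgood
  have hgm : ∀ K, MeasurableSet (good K) := by
    intro K
    have h1 : MeasurableSet {y : ℕ → ℝ | ∀ i, f₀ (y i) ≠ 0} := by
      rw [Set.ofPred_forall]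
      exact MeasurableSet.iInter fun i =>
        ((hE.pdf₀.1.comp (measurable_pi_apply i)) (measurableSet_singleton 0)).compl
    have h2 : MeasurableSet {y : ℕ → ℝ |
        ∀ n : ℕ, |∑ i ∈ Finset.range n, y i - n * m| ≤ K + η * n} := by
      rw [Set.ofPred_forall]
      refine MeasurableSet.iInter fun n => measurableSet_le ?_ measurable_const
      exact ((Finset.measurable_sum _ fun i _ => measurable_pi_apply i).sub
        measurable_const).abs
    exact h1.inter h2
  have hae : ∀ᵐ y ∂(iid ρ), y ∈ ⋃ K, good K := by
    have h1 : ∀ᵐ y ∂(iid ρ), ∀ i, f₀ (y i) ≠ 0 := by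
      refine ae_all_iff.2 fun i => ?_
      exact (measurePreserving_eval_infinitePi (fun _ : ℕ => ρ) i).quasiMeasurePreserving.ae
        (hE.ae_ne_zero hθ)
    have hmp : ∀ i, MeasurePreserving (fun y : ℕ → ℝ => y i) (iid ρ) ρ := fun i =>
      measurePreserving_eval_infinitePi (fun _ : ℕ => ρ) i
    have h2 := ProbabilityTheory.strong_law_ae_real (μ := iid ρ) (fun i y => y i)
      ((hmp 0).integrable_comp_of_integrable hid) (fun i j hij => by
        exact (ProbabilityTheory.iIndepFun_infinitePi (P := fun _ : ℕ => ρ)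
          (X := fun _ x => x) (fun _ => measurable_id)).indepFun hij)
      (fun i => ⟨(hmp i).aemeasurable, (hmp 0).aemeasurable, by rw [(hmp i).map_eq, (hmp 0).map_eq]⟩)
    have hmean : ∫ y, y 0 ∂(iid ρ) = m := by
      have := integral_map (hmp 0).aemeasurable (f := fun x : ℝ => x)
        (by rw [(hmp 0).map_eq]; exact hid.aestronglyMeasurable)
      rw [(hmp 0).map_eq] at this
      exact this.symm
    rw [hmean] at h2
    filter_upwards [h1, h2] with y hy1 hy2
    obtain ⟨K, hK⟩ := exists_abs_sub_le hη0 hy2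
    exact Set.mem_iUnion.2 ⟨K, hy1, hK⟩
  have hmono : Monotone good := by
    intro K K' hKK y hy
    refine ⟨hy.1, fun n => (hy.2 n).trans ?_⟩
    have : (K : ℝ) ≤ K' := by exact_mod_cast hKK
    linarith
  have hlim := tendsto_measure_iUnion_atTop (μ := iid ρ) hmono
  rw [(prob_compl_eq_zero_iff (MeasurableSet.iUnion hgm)).1 hae] at hlim
  have hlt : ENNReal.ofReal (1 - δ) < 1 := by
    rw [← ENNReal.ofReal_one]
    exact (ENNReal.ofReal_lt_ofReal_iff one_pos).2 (by linarith)
  obtain ⟨K, hK⟩ := (hlim.eventually (lt_mem_nhds hlt)).exists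
  refine ⟨2 * θu * K / δ, fun A hA => ?_⟩
  have hKA : 2 * θu * K ≤ δ * A := by rw [div_le_iff₀ hδ0] at hA; linarith
  have hA0 : 0 ≤ A := le_trans (by positivity) hA
  have hden : D + 2 * θu * η = D * (1 + δ) := by rw [hη]; field_simp
  have hpath : ∀ y ∈ good K, ENNReal.ofReal ((A - 2 * θu * K) / (D * (1 + δ)))
      ≤ (firstPassage (glrStat f₀ f Θ (fun _ => 1) (cons 0 y)) A : ℝ≥0∞) := by
    intro y hy
    set t := firstPassage (glrStat f₀ f Θ (fun _ => 1) (cons 0 y)) A with ht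
    by_cases htop : t = ⊤
    · rw [htop]; simp
    obtain ⟨n, hn⟩ := ENat.ne_top_iff_exists.1 htop
    obtain ⟨j, hj1, hjn, hj⟩ := firstPassage_le_iff.1 (ht.symm.trans hn.symm).le
    have h1 := EReal.coe_le_coe_iff.1 (hj.trans (hE.glrStat_cons_le (θu := θu) (D := D)
      (fun θ' h' => (hΘ0 θ' h').le) hΘu (fun θ' h' => hE.mean_llr_le hθ h' hid) hD.le hη0.le
      hy.1 hy.2 j))
    rw [hden] at h1
    rw [← hn, ENat.toENNReal_coe, ← ENNReal.ofReal_natCast]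
    refine ENNReal.ofReal_le_ofReal ?_
    rw [div_le_iff₀ (by positivity)]
    have h2 : (j : ℝ) ≤ n := by exact_mod_cast hjn
    have h3 : (j : ℝ) * (D * (1 + δ)) ≤ n * (D * (1 + δ)) :=
      mul_le_mul_of_nonneg_right h2 (by positivity)
    linarith
  have hnum : (1 - ε) * A / D ≤ (A - 2 * θu * K) / (D * (1 + δ)) * (1 - δ) := by
    have hδ1 : δ < 1 := by rw [hδ]; linarith
    rw [div_mul_eq_mul_div, div_le_div_iff₀ hD (by positivity)]
    have hεδ : ε = 3 * δ := by rw [hδ]; ring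
    have e1 : (1 - δ) * ((1 - δ) * A) ≤ (A - 2 * θu * K) * (1 - δ) := by
      have := mul_le_mul_of_nonneg_left (show (1 - δ) * A ≤ A - 2 * θu * K by linarith)
        (show 0 ≤ 1 - δ by linarith)
      linarith
    have e2 : (1 - ε) * A * (1 + δ) ≤ (1 - δ) * ((1 - δ) * A) := by
      rw [hεδ]
      have h0 : 0 ≤ A * δ ^ 2 := by positivity
      nlinarith
    have := mul_le_mul_of_nonneg_left (e2.trans e1) hD.le
    linarith
  calc ENNReal.ofReal ((1 - ε) * A / D)
      ≤ ENNReal.ofReal ((A - 2 * θu * K) / (D * (1 + δ)) * (1 - δ)) :=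
        ENNReal.ofReal_le_ofReal hnum
    _ = ENNReal.ofReal ((A - 2 * θu * K) / (D * (1 + δ))) * ENNReal.ofReal (1 - δ) :=
        ENNReal.ofReal_mul' (by rw [hδ]; linarith)
    _ ≤ ENNReal.ofReal ((A - 2 * θu * K) / (D * (1 + δ))) * iid ρ (good K) := by
        gcongr
        exact hK.le
    _ = ∫⁻ y, (good K).indicator
          (fun _ => ENNReal.ofReal ((A - 2 * θu * K) / (D * (1 + δ)))) y ∂(iid ρ) := by
        rw [lintegral_indicator_const (hgm K)]
    _ ≤ _ := by
        refine lintegral_mono fun y => ?_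
        by_cases hy : y ∈ good K
        · simpa only [Set.indicator_of_mem hy] using hpath y hy
        · simp only [Set.indicator_of_notMem hy, zero_le]

end IsExpFamily

/-! ### The false alarm rate of the GCuSum test -/

/-- Chernoff's bound. -/
lemma measure_sum_ge_le {ρ : Measure ℝ} [IsProbabilityMeasure ρ] {φ : ℝ → ℝ} (hφ : Measurable φ)
    {k n : ℕ} (a : ℝ) : iid ρ {x | a ≤ ∑ i ∈ Finset.Icc k n, φ (x i)}
      ≤ ENNReal.ofReal (Real.exp (-a)) *
        (∫⁻ x, ENNReal.ofReal (Real.exp (φ x)) ∂ρ) ^ (n + 1 - k) := by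
  have hX : ∀ i : ℕ, Measurable fun x : ℕ → ℝ => ENNReal.ofReal (Real.exp (φ (x i))) :=
    fun i => (hφ.comp (measurable_pi_apply i)).exp.ennreal_ofReal
  have hprod : ∫⁻ x, ∏ i ∈ Finset.Icc k n, ENNReal.ofReal (Real.exp (φ (x i))) ∂(iid ρ)
      = (∫⁻ x, ENNReal.ofReal (Real.exp (φ x)) ∂ρ) ^ (n + 1 - k) := by
    rw [ProbabilityTheory.lintegral_prod_eq_prod_lintegral_of_indepFun _
      (fun i (x : ℕ → ℝ) => ENNReal.ofReal (Real.exp (φ (x i))))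
      (ProbabilityTheory.iIndepFun_infinitePi (P := fun _ : ℕ => ρ)
        (X := fun _ x => ENNReal.ofReal (Real.exp (φ x))) fun _ => hφ.exp.ennreal_ofReal) hX]
    have : ∀ i : ℕ, ∫⁻ x : ℕ → ℝ, ENNReal.ofReal (Real.exp (φ (x i))) ∂(iid ρ)
        = ∫⁻ x, ENNReal.ofReal (Real.exp (φ x)) ∂ρ := fun i =>
      (measurePreserving_eval_infinitePi (fun _ : ℕ => ρ) i).lintegral_comp
        hφ.exp.ennreal_ofReal
    simp only [this, Finset.prod_const, Nat.card_Icc]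
  have hsub : {x : ℕ → ℝ | a ≤ ∑ i ∈ Finset.Icc k n, φ (x i)} ⊆
      {x | ENNReal.ofReal (Real.exp a)
        ≤ ∏ i ∈ Finset.Icc k n, ENNReal.ofReal (Real.exp (φ (x i)))} := by
    intro x hx
    rw [Set.mem_ofPred_eq] at hx ⊢
    rw [← ENNReal.ofReal_prod_of_nonneg fun i _ => (Real.exp_pos _).le, ← Real.exp_sum]
    exact ENNReal.ofReal_le_ofReal (Real.exp_le_exp.2 hx)
  have hpos : 0 < Real.exp a := Real.exp_pos a
  refine (measure_mono hsub).trans ((meas_ge_le_lintegral_div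
    (Finset.measurable_prod _ fun i _ => hX i).aemeasurable
    (ENNReal.ofReal_pos.2 hpos).ne' ENNReal.ofReal_ne_top).trans_eq ?_)
  rw [hprod, ENNReal.div_eq_inv_mul, ← ENNReal.ofReal_inv_of_pos hpos, Real.exp_neg]

/-- A sum of geometrically decaying terms that are also at most `a`: the first `Q` terms are
bounded by `a`, the others by the geometric series. -/
lemma sum_min_pow_le {a r : ℝ} (ha : 0 ≤ a) (hr0 : 0 ≤ r) (hr1 : r < 1) (Q N : ℕ) :
    ∑ l ∈ Finset.range N, min a (r ^ (l + 1)) ≤ Q * a + r ^ Q / (1 - r) := by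
  have hnn : ∀ l : ℕ, 0 ≤ min a (r ^ (l + 1)) := fun l => le_min ha (pow_nonneg hr0 _)
  calc ∑ l ∈ Finset.range N, min a (r ^ (l + 1))
      ≤ ∑ l ∈ Finset.range (Q + N), min a (r ^ (l + 1)) :=
        Finset.sum_le_sum_of_subset_of_nonneg
          (Finset.range_subset_range.2 (Nat.le_add_left N Q)) fun l _ _ => hnn l
    _ = ∑ l ∈ Finset.range Q, min a (r ^ (l + 1))
        + ∑ l ∈ Finset.range N, min a (r ^ (Q + l + 1)) := Finset.sum_range_add _ _ _
    _ ≤ ∑ _l ∈ Finset.range Q, a + ∑ l ∈ Finset.range N, r ^ Q * r ^ l := by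
        refine add_le_add (Finset.sum_le_sum fun l _ => min_le_left _ _)
          (Finset.sum_le_sum fun l _ => (min_le_right _ _).trans ?_)
        rw [← pow_add]
        exact pow_le_pow_of_le_one hr0 hr1.le (Nat.le_succ _)
    _ ≤ Q * a + r ^ Q / (1 - r) := by
        rw [Finset.sum_const, Finset.card_range, nsmul_eq_mul, ← Finset.mul_sum, div_eq_mul_inv,
          ← tsum_geometric_of_lt_one hr0 hr1]
        refine add_le_add le_rfl (mul_le_mul_of_nonneg_left ?_ (pow_nonneg hr0 _))
        exact (summable_geometric_of_lt_one hr0 hr1).sum_le_tsum _ fun l _ => pow_nonneg hr0 l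

namespace IsExpFamily

variable {ν : Measure ℝ} {f₀ : ℝ → ℝ} {f : ℝ → ℝ → ℝ} {b : ℝ → ℝ} {Θ : Set ℝ} {θ θ' : ℝ}

/-- `b θ / θ` is nondecreasing, by convexity and `b 0 = 0`. -/
lemma cumulant_le (hE : IsExpFamily ν f₀ f b Θ) (hθ : θ ∈ Θ) (hθ' : θ' ∈ Θ) (h0 : 0 < θ)
    (hle : θ ≤ θ') : b θ ≤ θ / θ' * b θ' := by
  have := isProbabilityMeasure_obsLaw hE.pdf₀
  have h0' : 0 < θ' := h0.trans_le hle
  set p := θ / θ' with hp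
  have hp0 : 0 ≤ p := by positivity
  have hp1 : p ≤ 1 := (div_le_one h0').2 hle
  have hei : ∀ t ∈ Θ, Integrable (fun x => Real.exp (t * x - b t)) (obsLaw ν f₀) := fun t ht =>
    integrable_exp_of_lintegral (by fun_prop) (by rw [hE.lintegral_exp ht]; exact ENNReal.one_ne_top)
  have he : ∀ t ∈ Θ, ∫ x, Real.exp (t * x - b t) ∂(obsLaw ν f₀) = 1 := fun t ht => by
    rw [integral_exp_eq (by fun_prop), hE.lintegral_exp ht, ENNReal.toReal_one]
  have hpt : ∀ x, Real.exp (b θ - p * b θ') * Real.exp (θ * x - b θ)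
      ≤ p * Real.exp (θ' * x - b θ') + (1 - p) := by
    intro x
    have := exp_mul_le hp0 hp1 (θ' * x - b θ')
    rw [← Real.exp_add]
    convert! this using 2
    rw [hp]; field_simp; ring
  have hsum : Integrable (fun x => p * Real.exp (θ' * x - b θ') + (1 - p)) (obsLaw ν f₀) :=
    ((hei θ' hθ').const_mul p).add (integrable_const (1 - p))
  have hint := integral_mono ((hei θ hθ).const_mul _) hsum hpt
  have e2 : ∫ x, (p * Real.exp (θ' * x - b θ') + (1 - p)) ∂(obsLaw ν f₀) = 1 := by
    rw [integral_add ((hei θ' hθ').const_mul p) (integrable_const _), integral_const_mul, he θ' hθ']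
    simp
  rw [integral_const_mul, he θ hθ, mul_one, e2, Real.exp_le_one_iff] at hint
  linarith

/-- The Hellinger affinity of `f θ` and `f₀` is below `1`, unless they coincide. -/
lemma lintegral_exp_half_lt_one (hE : IsExpFamily ν f₀ f b Θ) (hθ : θ ∈ Θ)
    (hpre : 0 < divPre ν f₀ (f θ)) :
    ∃ r : ℝ, 0 < r ∧ r < 1 ∧
      ∫⁻ x, ENNReal.ofReal (Real.exp ((θ * x - b θ) / 2)) ∂(obsLaw ν f₀) = ENNReal.ofReal r := by
  have := isProbabilityMeasure_obsLaw hE.pdf₀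
  set P := obsLaw ν f₀ with hP
  set φ : ℝ → ℝ := fun x => θ * x - b θ with hφ
  have hφm : Measurable φ := by fun_prop
  have he : Integrable (fun x => Real.exp (φ x)) P :=
    integrable_exp_of_lintegral hφm (by rw [hE.lintegral_exp hθ]; exact ENNReal.one_ne_top)
  have hone : ∫ x, Real.exp (φ x) ∂P = 1 := by
    rw [integral_exp_eq hφm, hE.lintegral_exp hθ, ENNReal.toReal_one]
  have hsq : ∀ x, Real.exp (φ x) = Real.exp (φ x / 2) ^ 2 := by
    intro x
    rw [sq, ← Real.exp_add]
    congr 1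
    ring
  have hhalf : Integrable (fun x => Real.exp (φ x / 2)) P := by
    refine (((integrable_const 1).add he)).mono' (hφm.div_const 2).exp.aestronglyMeasurable
      (Eventually.of_forall fun x => ?_)
    rw [Real.norm_of_nonneg (Real.exp_pos _).le, Pi.add_apply, hsq]
    nlinarith [sq_nonneg (Real.exp (φ x / 2) - 1)]
  have hsqi : Integrable (fun x => (Real.exp (φ x / 2) - 1) ^ 2) P := by
    refine ((he.sub (hhalf.const_mul 2)).add (integrable_const 1)).congr
      (Eventually.of_forall fun x => ?_)
    simp only [Pi.add_apply, Pi.sub_apply, hsq]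
    ring
  have hval : ∫ x, (Real.exp (φ x / 2) - 1) ^ 2 ∂P = 2 - 2 * ∫ x, Real.exp (φ x / 2) ∂P := by
    have e1 : ∀ x, (Real.exp (φ x / 2) - 1) ^ 2
        = (Real.exp (φ x) - 2 * Real.exp (φ x / 2)) + 1 := by
      intro x; rw [hsq]; ring
    have hsub : Integrable (fun x => Real.exp (φ x) - 2 * Real.exp (φ x / 2)) P :=
      he.sub (hhalf.const_mul 2)
    simp only [e1]
    rw [integral_add hsub (integrable_const 1), integral_sub he (hhalf.const_mul 2),
      integral_const_mul, hone]
    simp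
    ring
  have hne : ∫ x, (Real.exp (φ x / 2) - 1) ^ 2 ∂P ≠ 0 := by
    intro h0
    rw [integral_eq_zero_iff_of_nonneg (fun x => sq_nonneg _) hsqi] at h0
    have : ∫ x, llr f₀ (f θ) x ∂P = 0 := by
      rw [integral_eq_zero_of_ae]
      filter_upwards [h0, ae_obsLaw_ne_zero hE.pdf₀] with x hx hx0
      rw [hE.llr_eq hθ hx0]
      have h1 : Real.exp (φ x / 2) = 1 := by
        have := pow_eq_zero_iff (two_ne_zero) |>.1 hx
        linarith
      have h2 := (Real.exp_eq_one_iff _).1 h1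
      simp only [Pi.zero_apply]
      simp only [hφ] at h2
      linarith
    rw [divPre, ← hP, this] at hpre
    simp at hpre
  have hnn : 0 ≤ ∫ x, (Real.exp (φ x / 2) - 1) ^ 2 ∂P := integral_nonneg fun x => sq_nonneg _
  have hpos : 0 < ∫ x, (Real.exp (φ x / 2) - 1) ^ 2 ∂P := lt_of_le_of_ne hnn hne.symm
  refine ⟨∫ x, Real.exp (φ x / 2) ∂P, integral_exp_pos hhalf, by linarith, ?_⟩
  exact (ofReal_integral_eq_lintegral_ofReal hhalf
    (Eventually.of_forall fun x => (Real.exp_pos _).le)).symm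

lemma usedSum_llr_eq (hE : IsExpFamily ν f₀ f b Θ) (hθ : θ ∈ Θ) {x : ℕ → ℝ}
    (hx : ∀ i, f₀ (x i) ≠ 0) (k n : ℕ) :
    usedSum (fun _ => 1) (llr f₀ (f θ)) x k n = ∑ i ∈ Finset.Icc k n, (θ * x i - b θ) :=
  Finset.sum_congr rfl fun i _ => by rw [one_mul, hE.llr_eq hθ (hx i)]

lemma sum_affine_eq (x : ℕ → ℝ) (t c : ℝ) (k n : ℕ) : ∑ i ∈ Finset.Icc k n, (t * x i - c)
    = t * ∑ i ∈ Finset.Icc k n, x i - (n + 1 - k : ℕ) * c := by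
  rw [Finset.sum_sub_distrib, Finset.mul_sum, Finset.sum_const, Nat.card_Icc, nsmul_eq_mul]

/-- Since `θ > 0`, the likelihood ratio of `f θ` exceeds a level exactly if the sum of the
observations exceeds some level. The events for different `θ` are therefore nested, and the
supremum over `θ` costs no more than a single parameter that is nearly optimal for the number of
observations at hand. -/
lemma measure_sup_ge_le_exp (hE : IsExpFamily ν f₀ f b Θ) {θl θu : ℝ} (hθl : 0 < θl)
    (hlΘ : θl ∈ Θ) (hΘ : Θ ⊆ Set.Icc θl θu) {A : ℝ} (hA : 1 ≤ A) (k n : ℕ) :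
    iid (obsLaw ν f₀) {x | (∀ i, f₀ (x i) ≠ 0) ∧
      (A : EReal) ≤ ⨆ θ ∈ Θ, ((usedSum (fun _ => 1) (llr f₀ (f θ)) x k n : ℝ) : EReal)}
      ≤ ENNReal.ofReal (Real.exp (1 - A)) := by
  have := isProbabilityMeasure_obsLaw hE.pdf₀
  set l : ℝ := ((n + 1 - k : ℕ) : ℝ) with hl
  have hl0 : 0 ≤ l := Nat.cast_nonneg _
  have hΘ0 : ∀ θ ∈ Θ, 0 < θ := fun θ hθ => hθl.trans_le (hΘ hθ).1
  have hθu : 0 < θu := hθl.trans_le (hΘ hlΘ).2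
  -- the level that the sum has to exceed, for the parameter `θ`
  set s : ℝ → ℝ := fun θ => (A - 1 / 2 + l * b θ) / θ with hs
  have hbdd : BddBelow (s '' Θ) := by
    refine ⟨l * (b θl / θl), ?_⟩
    rintro _ ⟨θ, hθ, rfl⟩
    have h1 := hE.cumulant_le hlΘ hθ hθl (hΘ hθ).1
    simp only [hs]
    rw [le_div_iff₀ (hΘ0 θ hθ)]
    have h2 : b θl / θl * θ ≤ b θ := by
      have h3 := mul_le_mul_of_nonneg_right h1 (div_nonneg (hΘ0 θ hθ).le hθl.le)
      have e : θl / θ * b θ * (θ / θl) = b θ := by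
        have := (hΘ0 θ hθ).ne'
        field_simp
      rw [e] at h3
      calc b θl / θl * θ = b θl * (θ / θl) := by ring
        _ ≤ b θ := h3
    nlinarith [mul_le_mul_of_nonneg_left h2 hl0]
  obtain ⟨_, ⟨θs, hθs, rfl⟩, hlt⟩ := exists_lt_of_csInf_lt (Set.Nonempty.image s ⟨θl, hlΘ⟩)
    (lt_add_of_pos_right (sInf (s '' Θ)) (show 0 < 1 / (2 * θu) by positivity))
  have hsub : {x : ℕ → ℝ | (∀ i, f₀ (x i) ≠ 0) ∧
      (A : EReal) ≤ ⨆ θ ∈ Θ, ((usedSum (fun _ => 1) (llr f₀ (f θ)) x k n : ℝ) : EReal)}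
      ⊆ {x | A - 1 ≤ ∑ i ∈ Finset.Icc k n, (fun y => θs * y - b θs) (x i)} := by
    rintro x ⟨hx, hAx⟩
    have hlt2 : ((A - 1 / 2 : ℝ) : EReal)
        < ⨆ θ ∈ Θ, ((usedSum (fun _ => 1) (llr f₀ (f θ)) x k n : ℝ) : EReal) :=
      (EReal.coe_lt_coe_iff.2 (by linarith)).trans_le hAx
    obtain ⟨θ, hθlt⟩ := lt_iSup_iff.1 hlt2
    obtain ⟨hθ, hθlt⟩ := lt_iSup_iff.1 hθlt
    have h1 := EReal.coe_lt_coe_iff.1 hθlt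
    rw [hE.usedSum_llr_eq hθ hx, sum_affine_eq, ← hl] at h1
    rw [Set.mem_ofPred_eq]
    simp only
    rw [sum_affine_eq, ← hl]
    set S := ∑ i ∈ Finset.Icc k n, x i
    have h2 : s θ < S := by
      simp only [hs]
      rw [div_lt_iff₀ (hΘ0 θ hθ)]
      linarith
    have h3 : s θs - 1 / (2 * θu) < S := by
      have := csInf_le hbdd (Set.mem_image_of_mem s hθ)
      linarith
    have h4 : θs * (s θs - 1 / (2 * θu)) < θs * S := mul_lt_mul_of_pos_left h3 (hΘ0 θs hθs)
    have h5 : θs * s θs = A - 1 / 2 + l * b θs := by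
      simp only [hs]
      rw [mul_div_cancel₀ _ (hΘ0 θs hθs).ne']
    have h6 : θs * (1 / (2 * θu)) ≤ 1 / 2 := by
      rw [mul_one_div, div_le_div_iff₀ (by positivity) (by norm_num)]
      linarith [(hΘ hθs).2]
    linarith
  refine (measure_mono hsub).trans
    ((measure_sum_ge_le (φ := fun y => θs * y - b θs) (by fun_prop) _).trans_eq ?_)
  rw [hE.lintegral_exp hθs, one_pow, mul_one]
  congr 2
  ring

/-- By monotonicity of `b θ / θ`, a positive log-likelihood ratio for some `θ` forces that for the
smallest parameter `θl` to be nonnegative, which is exponentially unlikely for long sums. -/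
lemma measure_sup_ge_le_pow (hE : IsExpFamily ν f₀ f b Θ) {θl : ℝ} (hθl : 0 < θl)
    (hlΘ : θl ∈ Θ) (hΘ : ∀ θ ∈ Θ, θl ≤ θ) {r : ℝ}
    (hr : ∫⁻ x, ENNReal.ofReal (Real.exp ((θl * x - b θl) / 2)) ∂(obsLaw ν f₀)
      = ENNReal.ofReal r) {A : ℝ} (hA : 0 < A) (k n : ℕ) :
    iid (obsLaw ν f₀) {x | (∀ i, f₀ (x i) ≠ 0) ∧
      (A : EReal) ≤ ⨆ θ ∈ Θ, ((usedSum (fun _ => 1) (llr f₀ (f θ)) x k n : ℝ) : EReal)}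
      ≤ ENNReal.ofReal r ^ (n + 1 - k) := by
  have := isProbabilityMeasure_obsLaw hE.pdf₀
  set l : ℝ := ((n + 1 - k : ℕ) : ℝ) with hl
  have hl0 : 0 ≤ l := Nat.cast_nonneg _
  have hsub : {x : ℕ → ℝ | (∀ i, f₀ (x i) ≠ 0) ∧
      (A : EReal) ≤ ⨆ θ ∈ Θ, ((usedSum (fun _ => 1) (llr f₀ (f θ)) x k n : ℝ) : EReal)}
      ⊆ {x | (0 : ℝ) ≤ ∑ i ∈ Finset.Icc k n, (fun y => (θl * y - b θl) / 2) (x i)} := by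
    rintro x ⟨hx, hAx⟩
    obtain ⟨θ, hθlt⟩ := lt_iSup_iff.1 ((EReal.coe_lt_coe_iff.2 hA).trans_le hAx)
    obtain ⟨hθ, hθlt⟩ := lt_iSup_iff.1 hθlt
    have h1 := EReal.coe_lt_coe_iff.1 hθlt
    rw [hE.usedSum_llr_eq hθ hx, sum_affine_eq, ← hl] at h1
    rw [Set.mem_ofPred_eq]
    simp only
    rw [← Finset.sum_div, sum_affine_eq, ← hl]
    set S := ∑ i ∈ Finset.Icc k n, x i
    have hθ0 : 0 < θ := hθl.trans_le (hΘ θ hθ)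
    have h2 := hE.cumulant_le hlΘ hθ hθl (hΘ θ hθ)
    have h3 : l * b θl ≤ l * (θl / θ * b θ) := mul_le_mul_of_nonneg_left h2 hl0
    have h4 : 0 ≤ θl / θ * (θ * S - l * b θ) :=
      mul_nonneg (by positivity) h1.le
    have h5 : θl / θ * (θ * S - l * b θ) = θl * S - l * (θl / θ * b θ) := by
      field_simp
    linarith
  refine (measure_mono hsub).trans
    ((measure_sum_ge_le (φ := fun y => (θl * y - b θl) / 2) (by fun_prop) _).trans_eq ?_)
  rw [hr]
  simp

/-- The GCuSum test raises a false alarm up to time `N` with probability at most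
`N K (1 + A) e^{-A}`: for each end point, only about `A / log (1/r)` starting points matter. -/
lemma measure_firstPassage_le (hE : IsExpFamily ν f₀ f b Θ) {θl θu : ℝ} (hθl : 0 < θl)
    (hlΘ : θl ∈ Θ) (hΘ : Θ ⊆ Set.Icc θl θu) (hpre : 0 < divPre ν f₀ (f θl)) :
    ∃ K : ℝ, 0 < K ∧ ∀ A : ℝ, 1 ≤ A → ∀ N : ℕ,
      iid (obsLaw ν f₀) {x | firstPassage (glrStat f₀ f Θ (fun _ => 1) x) A ≤ N}
        ≤ ENNReal.ofReal (N * (K * (1 + A) * Real.exp (-A))) := by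
  obtain ⟨r, hr0, hr1, hr⟩ := hE.lintegral_exp_half_lt_one hlΘ hpre
  set c := -Real.log r with hc
  have hc0 : 0 < c := neg_pos.2 (Real.log_neg hr0 hr1)
  have hr1' : 0 < 1 - r := by linarith
  set K := Real.exp 1 * (1 / c + 1) + 1 / (1 - r) with hK
  have hK0 : 0 < K := by positivity
  refine ⟨K, hK0, fun A hA N => ?_⟩
  set P := iid (obsLaw ν f₀) with hP
  set a := Real.exp (1 - A) with ha
  have ha0 : 0 < a := Real.exp_pos _
  set E : ℕ → ℕ → Set (ℕ → ℝ) := fun k n => {x | (∀ i, f₀ (x i) ≠ 0) ∧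
      (A : EReal) ≤ ⨆ θ ∈ Θ, ((usedSum (fun _ => 1) (llr f₀ (f θ)) x k n : ℝ) : EReal)} with hEE
  have hEle : ∀ k n, P (E k n) ≤ ENNReal.ofReal (min a (r ^ (n + 1 - k))) := by
    intro k n
    rw [ENNReal.ofReal_min]
    refine le_min (hE.measure_sup_ge_le_exp hθl hlΘ hΘ hA k n) ?_
    rw [ENNReal.ofReal_pow hr0.le]
    exact hE.measure_sup_ge_le_pow hθl hlΘ (fun θ hθ => (hΘ hθ).1) hr (by linarith) k n
  have hsum : ∀ n : ℕ, ∑ k ∈ Finset.Icc 1 n, min a (r ^ (n + 1 - k))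
      ≤ K * (1 + A) * Real.exp (-A) := by
    intro n
    have hrefl : ∑ k ∈ Finset.Icc 1 n, min a (r ^ (n + 1 - k))
        = ∑ l ∈ Finset.range n, min a (r ^ (l + 1)) := by
      refine Finset.sum_bij' (fun k _ => n - k) (fun l _ => n - l) ?_ ?_ ?_ ?_ ?_ <;>
        simp only [Finset.mem_Icc, Finset.mem_range]
      · intro k hk; omega
      · intro l hl; omega
      · intro k hk; omega
      · intro l hl; omega
      · intro k hk; rw [show n + 1 - k = n - k + 1 by omega]
    rw [hrefl]
    set Q := ⌈A / c⌉₊ with hQ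
    have hQ1 : A / c ≤ Q := Nat.le_ceil _
    have hQ2 : (Q : ℝ) ≤ A / c + 1 := (Nat.ceil_lt_add_one (by positivity)).le
    have hrQ : r ^ Q ≤ Real.exp (-A) := by
      rw [← Real.rpow_natCast, Real.rpow_def_of_pos hr0]
      refine Real.exp_le_exp.2 ?_
      rw [div_le_iff₀ hc0, hc] at hQ1
      linarith
    have hea : a = Real.exp 1 * Real.exp (-A) := by rw [ha, ← Real.exp_add]; congr 1
    have hexp := Real.exp_pos (-A)
    calc ∑ l ∈ Finset.range n, min a (r ^ (l + 1))
        ≤ Q * a + r ^ Q / (1 - r) := sum_min_pow_le ha0.le hr0.le hr1 Q n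
      _ ≤ (A / c + 1) * a + Real.exp (-A) / (1 - r) := by gcongr
      _ = (Real.exp 1 * (A * (1 / c) + 1) + 1 / (1 - r)) * Real.exp (-A) := by rw [hea]; ring
      _ ≤ K * (1 + A) * Real.exp (-A) := by
          refine mul_le_mul_of_nonneg_right ?_ hexp.le
          have h1 : 0 < Real.exp 1 := Real.exp_pos 1
          have h2 : 0 < 1 / c := by positivity
          have h3 : 0 < 1 / (1 - r) := by positivity
          have e : K * (1 + A) = (Real.exp 1 * (A * (1 / c) + 1) + 1 / (1 - r))
              + (Real.exp 1 * (1 / c) + Real.exp 1 * A + 1 / (1 - r) * A) := by rw [hK]; ring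
          rw [e]
          have : 0 ≤ Real.exp 1 * (1 / c) + Real.exp 1 * A + 1 / (1 - r) * A := by positivity
          linarith
  have hgood : ∀ᵐ x ∂P, ∀ i, f₀ (x i) ≠ 0 := by
    have := isProbabilityMeasure_obsLaw hE.pdf₀
    refine ae_all_iff.2 fun i => ?_
    exact (measurePreserving_eval_infinitePi
      (fun _ : ℕ => obsLaw ν f₀) i).quasiMeasurePreserving.ae (ae_obsLaw_ne_zero hE.pdf₀)
  have hsub : {x : ℕ → ℝ | firstPassage (glrStat f₀ f Θ (fun _ => 1) x) A ≤ N}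
      ≤ᵐ[P] ⋃ n ∈ Finset.Icc 1 N, ⋃ k ∈ Finset.Icc 1 n, E k n := by
    filter_upwards [hgood] with x hx hle
    obtain ⟨n, hn1, hnN, hn⟩ := firstPassage_le_iff.1 hle
    obtain ⟨k, hk, hkA⟩ := le_glrStat_iff.1 hn
    exact Set.mem_biUnion (Finset.mem_Icc.2 ⟨hn1, hnN⟩) (Set.mem_biUnion hk ⟨hx, hkA⟩)
  calc P {x | firstPassage (glrStat f₀ f Θ (fun _ => 1) x) A ≤ N}
      ≤ P (⋃ n ∈ Finset.Icc 1 N, ⋃ k ∈ Finset.Icc 1 n, E k n) := measure_mono_ae hsub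
    _ ≤ ∑ n ∈ Finset.Icc 1 N, ∑ k ∈ Finset.Icc 1 n, P (E k n) :=
        (measure_biUnion_finset_le _ _).trans
          (Finset.sum_le_sum fun n _ => measure_biUnion_finset_le _ _)
    _ ≤ ∑ _n ∈ Finset.Icc 1 N, ENNReal.ofReal (K * (1 + A) * Real.exp (-A)) := by
        refine Finset.sum_le_sum fun n _ => ?_
        refine (Finset.sum_le_sum fun k _ => hEle k n).trans ?_
        rw [← ENNReal.ofReal_sum_of_nonneg fun k _ => le_min ha0.le (pow_nonneg hr0.le _)]
        exact ENNReal.ofReal_le_ofReal (hsum n)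
    _ = ENNReal.ofReal (N * (K * (1 + A) * Real.exp (-A))) := by
        rw [Finset.sum_const, Nat.card_Icc, Nat.add_sub_cancel, nsmul_eq_mul,
          ENNReal.ofReal_mul (Nat.cast_nonneg N), ENNReal.ofReal_natCast]

/-- A stopping time that has stopped by time `N` with probability at most `N B` has mean at least
`1 / (4 B)`: at time `N ≈ 1 / (2 B)` it is still running with probability at least `1 / 2`. -/
lemma far_gcusum_le (hE : IsExpFamily ν f₀ f b Θ) {θl θu : ℝ} (hθl : 0 < θl)
    (hlΘ : θl ∈ Θ) (hΘ : Θ ⊆ Set.Icc θl θu) (hpre : 0 < divPre ν f₀ (f θl)) :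
    ∃ K : ℝ, 0 < K ∧ ∀ A : ℝ, 1 ≤ A →
      FAR ν f₀ (gcusum f₀ f Θ A) ≤ ENNReal.ofReal (K * (1 + A) * Real.exp (-A)) := by
  have := isProbabilityMeasure_obsLaw hE.pdf₀
  obtain ⟨K, hK0, hK⟩ := hE.measure_firstPassage_le hθl hlΘ hΘ hpre
  refine ⟨4 * K, by positivity, fun A hA => ?_⟩
  set B := K * (1 + A) * Real.exp (-A) with hB
  have hB0 : 0 < B := by
    have := Real.exp_pos (-A)
    have : 0 < 1 + A := by linarith
    positivity
  rw [show 4 * K * (1 + A) * Real.exp (-A) = (1 / (4 * B))⁻¹ by rw [hB]; field_simp,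
    ENNReal.ofReal_inv_of_pos (by positivity)]
  refine ENNReal.inv_le_inv.2 ?_
  set N := ⌊1 / (2 * B)⌋₊ with hN
  have hN1 : N * B ≤ 1 / 2 := by
    have h1 : (N : ℝ) ≤ 1 / (2 * B) := Nat.floor_le (by positivity)
    rw [le_div_iff₀ (by positivity)] at h1
    linarith
  have hN2 : 1 / (2 * B) ≤ (N : ℝ) + 1 := (Nat.lt_floor_add_one _).le
  set τ : (ℕ → ℝ) → ℕ∞ := fun x => firstPassage (glrStat f₀ f Θ (fun _ => 1) x) A with hτ
  have hτm : Measurable τ := hE.measurable_firstPassage A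
  have hset : MeasurableSet {x | τ x ≤ N} := hτm (MeasurableSet.of_discrete (s := Set.Iic (N : ℕ∞)))
  have hcompl : ENNReal.ofReal (1 / 2) ≤ iid (obsLaw ν f₀) {x | τ x ≤ N}ᶜ := by
    rw [prob_compl_eq_one_sub hset]
    refine le_trans ?_ (tsub_le_tsub_left ((hK A hA N).trans (ENNReal.ofReal_le_ofReal hN1)) 1)
    rw [← ENNReal.ofReal_one, ← ENNReal.ofReal_sub _ (by norm_num)]
    norm_num
  calc ENNReal.ofReal (1 / (4 * B))
      = ENNReal.ofReal (1 / (2 * B)) * ENNReal.ofReal (1 / 2) := by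
        rw [← ENNReal.ofReal_mul (by positivity)]
        congr 1
        field_simp
        norm_num
    _ ≤ ENNReal.ofReal ((N : ℝ) + 1) * iid (obsLaw ν f₀) {x | τ x ≤ N}ᶜ :=
        mul_le_mul' (ENNReal.ofReal_le_ofReal hN2) hcompl
    _ = ∫⁻ x, {x | τ x ≤ N}ᶜ.indicator (fun _ => ENNReal.ofReal ((N : ℝ) + 1)) x
          ∂(iid (obsLaw ν f₀)) := by
        rw [lintegral_indicator_const hset.compl]
    _ ≤ ∫⁻ x, (τ x : ℝ≥0∞) ∂(iid (obsLaw ν f₀)) := by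
        refine lintegral_mono fun x => ?_
        by_cases hx : x ∈ {x | τ x ≤ N}ᶜ
        · rw [Set.indicator_of_mem hx]
          have h1 : ((N + 1 : ℕ) : ℕ∞) ≤ τ x := by
            have : (N : ℕ∞) < τ x := not_le.1 hx
            push_cast
            exact Order.add_one_le_of_lt this
          have h2 := ENat.toENNReal_le.2 h1
          rw [ENat.toENNReal_coe, ← ENNReal.ofReal_natCast] at h2
          push_cast at h2
          exact h2
        · rw [Set.indicator_of_notMem hx]
          exact zero_le

end IsExpFamily

/-! ### Asymptotics of the detection delay -/

/-- The mean run length without an observed past bounds the worst case delay from below. -/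
lemma lintegral_tau_le_wadd_add_one {ν : Measure ℝ} {f₀ g : ℝ → ℝ} (hf₀ : IsPDF ν f₀)
    (hg : IsPDF ν g) (Ψ : Policy) :
    ∫⁻ x, (Ψ.τ x : ℝ≥0∞) ∂(lawChange ν f₀ g 1) ≤ WADD ν f₀ g Ψ + 1 := by
  have := isProbabilityMeasure_lawChange hf₀ hg 1
  have hinfo : Ψ.info 0 = ⊥ := by simp [Policy.info]
  have h1 : ∫⁻ x, ((Ψ.τ x : ℝ≥0∞) - 1) ∂(lawChange ν f₀ g 1) ≤ WADD ν f₀ g Ψ := by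
    refine le_trans ?_ (le_iSup₂ (f := fun (γ : ℕ) (_ : 1 ≤ γ) =>
      essSup (condLExp (Ψ.info (γ - 1)) (lawChange ν f₀ g γ)
        (fun x => (Ψ.τ x : ℝ≥0∞) - (γ : ℝ≥0∞))) (lawChange ν f₀ g γ)) 1 le_rfl)
    simp only [Nat.sub_self, hinfo, condLExp_bot, Nat.cast_one]
    rw [essSup_const _ (IsProbabilityMeasure.ne_zero _)]
  calc ∫⁻ x, (Ψ.τ x : ℝ≥0∞) ∂(lawChange ν f₀ g 1)
      ≤ ∫⁻ x, (((Ψ.τ x : ℝ≥0∞) - 1) + 1) ∂(lawChange ν f₀ g 1) :=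
        lintegral_mono fun x => le_tsub_add
    _ = ∫⁻ x, ((Ψ.τ x : ℝ≥0∞) - 1) ∂(lawChange ν f₀ g 1) + 1 := by
        rw [lintegral_add_right _ measurable_const]; simp
    _ ≤ WADD ν f₀ g Ψ + 1 := add_le_add h1 le_rfl

/-- Truncating the increments costs an arbitrarily small part of the drift. -/
lemma exists_le_integral_min {P : Measure ℝ} [IsProbabilityMeasure P] {L : ℝ → ℝ}
    (hLi : Integrable L P) (hLpos : 0 < ∫ x, L x ∂P) {ε : ℝ} (hε : 0 < ε) :
    ∃ c : ℝ, 0 ≤ c ∧ (∫ x, L x ∂P) / (1 + ε) ≤ ∫ x, min (L x) c ∂P := by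
  have hlim : Tendsto (fun n : ℕ => ∫ x, min (L x) n ∂P) atTop (𝓝 (∫ x, L x ∂P)) := by
    refine tendsto_integral_of_dominated_convergence (fun x => |L x|)
      (fun n => hLi.aestronglyMeasurable.inf aestronglyMeasurable_const) hLi.abs
      (fun n => Eventually.of_forall fun x => ?_) (Eventually.of_forall fun x => ?_)
    · have hn : (0 : ℝ) ≤ n := Nat.cast_nonneg n
      rw [Real.norm_eq_abs, abs_le]
      exact ⟨le_min (neg_abs_le _) ((neg_nonpos.2 (abs_nonneg _)).trans hn),
        (min_le_left _ _).trans (le_abs_self _)⟩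
    · obtain ⟨N, hN⟩ := exists_nat_ge (L x)
      refine tendsto_const_nhds.congr' ?_
      filter_upwards [eventually_ge_atTop N] with n hn
      rw [min_eq_left (hN.trans (by exact_mod_cast hn))]
  have hlt : (∫ x, L x ∂P) / (1 + ε) < ∫ x, L x ∂P := by
    rw [div_lt_iff₀ (by linarith)]
    nlinarith
  obtain ⟨n, hn⟩ := (hlim.eventually (lt_mem_nhds hlt)).exists
  exact ⟨n, Nat.cast_nonneg n, hn.le⟩

/-- First order upper bound for the worst case delay of a test whose control admits a bounded
potential for the number of skipped observations. -/
lemma Control.exists_wadd_le (C : Control) {ν : Measure ℝ} {f₀ : ℝ → ℝ} {f : ℝ → ℝ → ℝ} {Θ : Set ℝ}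
    {θ : ℝ} (hf₀ : IsPDF ν f₀) (hθ : θ ∈ Θ) (hg : IsPDF ν (f θ))
    (hLi : Integrable (llr f₀ (f θ)) (obsLaw ν (f θ))) (hD : 0 < divPost ν f₀ (f θ))
    {V : ℝ → ℝ} {B : ℝ} (hV0 : ∀ w, 0 ≤ V w)
    (hVi : ∀ w, 0 ≤ w → Integrable (fun x => V (C.adv w x)) (obsLaw ν (f θ)))
    (hVadv : ∀ w, 0 ≤ w → ∫ x, V (C.adv w x) ∂(obsLaw ν (f θ)) ≤ V w)
    (hVskip : ∀ w, w < 0 → 1 + V (C.skip w) ≤ V w)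
    (hVB : ∀ n x, V (C.state n 0 x) ≤ B) {ε : ℝ} (hε : 0 < ε) :
    ∃ K : ℝ, ∀ A : ℝ, 0 < A → ∀ Ψ : Policy, (∀ k x, 1 ≤ k → Ψ.S k x = C.used x k) →
      (∀ x, Ψ.τ x = firstPassage (glrStat f₀ f Θ (C.used x) x) A) →
      WADD ν f₀ (f θ) Ψ ≤ ENNReal.ofReal ((1 + ε) * A / divPost ν f₀ (f θ) + K) := by
  have := isProbabilityMeasure_obsLaw hg
  set D := divPost ν f₀ (f θ) with hDdef
  obtain ⟨c, hc0, hc⟩ := exists_le_integral_min hLi hD hε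
  change D / (1 + ε) ≤ _ at hc
  set d := ∫ x, min (llr f₀ (f θ) x) c ∂(obsLaw ν (f θ)) with hd
  have hd0 : 0 < d := lt_of_lt_of_le (by positivity) hc
  refine ⟨(1 + ε) * c / D + B, fun A hA Ψ hS hτ => ?_⟩
  refine (C.wadd_le hA hS hτ hf₀ hθ hg ((measurable_llr hf₀ hg).min measurable_const)
    (hLi.inf (integrable_const c)) (fun x => min_le_left _ _) hc0 (fun x => min_le_right _ _)
    hd.symm hd0 hV0 hVi hVadv hVskip hVB).trans (ENNReal.ofReal_le_ofReal ?_)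
  have h1 : (A + c) / d ≤ (1 + ε) * (A + c) / D := by
    rw [div_le_div_iff₀ hd0 hD]
    rw [div_le_iff₀ (by linarith)] at hc
    have := mul_le_mul_of_nonneg_left hc (show 0 ≤ A + c by linarith)
    linarith
  have h2 : (1 + ε) * (A + c) / D = (1 + ε) * A / D + (1 + ε) * c / D := by ring
  linarith

lemma tendsto_log_one_div : Tendsto (fun α : ℝ => Real.log (1 / α)) (𝓝[>] 0) atTop := by
  simp only [one_div]
  exact Real.tendsto_log_atTop.comp tendsto_inv_nhdsGT_zero

lemma IsThreshold.tendsto_atTop {A : ℝ → ℝ} (hA : IsThreshold A) :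
    Tendsto A (𝓝[>] 0) atTop := by
  refine (hA.pos_mul_atTop one_pos tendsto_log_one_div).congr' ?_
  filter_upwards [tendsto_log_one_div.eventually_gt_atTop 0] with α hα
  field_simp

lemma IsThreshold.tendsto_affine {A : ℝ → ℝ} (hA : IsThreshold A) {D : ℝ} (hD : 0 < D) (p q : ℝ) :
    Tendsto (fun α => (p * A α / D + q) / (|Real.log α| / D)) (𝓝[>] 0) (𝓝 p) := by
  have h1 : Tendsto (fun α : ℝ => p * (A α / Real.log (1 / α)) + q * D / Real.log (1 / α))
      (𝓝[>] 0) (𝓝 (p * 1 + 0)) :=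
    (hA.const_mul p).add (tendsto_log_one_div.const_div_atTop _)
  rw [mul_one, add_zero] at h1
  refine h1.congr' ?_
  filter_upwards [tendsto_log_one_div.eventually_gt_atTop 0] with α hα
  have e : |Real.log α| = Real.log (1 / α) := by
    rw [one_div, Real.log_inv] at hα ⊢
    exact abs_of_neg (by linarith)
  rw [e]
  field_simp

lemma eventually_abs_log_div_pos {D : ℝ} (hD : 0 < D) :
    ∀ᶠ α in 𝓝[>] (0 : ℝ), 0 < |Real.log α| / D := by
  filter_upwards [tendsto_log_one_div.eventually_gt_atTop 0] with α hα
  rw [one_div, Real.log_inv] at hα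
  have : Real.log α ≠ 0 := by linarith
  positivity

/-- Matching bounds of first order in the threshold give the asymptotics in `α`. -/
lemma asympEq_of_bounds {A : ℝ → ℝ} (hA : IsThreshold A) {D : ℝ} (hD : 0 < D) {u : ℝ → ℝ≥0∞}
    (hlow : ∀ ε : ℝ, 0 < ε → ε < 1 → ∃ A₀, ∀ α, A₀ ≤ A α →
      ENNReal.ofReal ((1 - ε) * A α / D) ≤ u α + 1)
    (hup : ∀ ε : ℝ, 0 < ε → ∃ K, ∀ α, 0 < A α → u α ≤ ENNReal.ofReal ((1 + ε) * A α / D + K)) :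
    AsympEq u fun α => ENNReal.ofReal (|Real.log α| / D) := by
  refine tendsto_order.2 ⟨fun a ha => ?_, fun a ha => ?_⟩
  · have hatop : a ≠ ∞ := ha.ne_top
    set a' := a.toReal with ha'
    have ha0 : 0 ≤ a' := ENNReal.toReal_nonneg
    have ha1 : a' < 1 := by
      rw [ha', ← ENNReal.toReal_one]
      exact (ENNReal.toReal_lt_toReal hatop ENNReal.one_ne_top).2 ha
    obtain ⟨A₀, hA₀⟩ := hlow ((1 - a') / 2) (by linarith) (by linarith)
    have hlim := (hA.tendsto_affine hD (1 - (1 - a') / 2) (-1)).eventually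
      (lt_mem_nhds (show a' < 1 - (1 - a') / 2 by linarith))
    filter_upwards [hlim, hA.tendsto_atTop.eventually_ge_atTop A₀, eventually_abs_log_div_pos hD]
      with α h1 h2 h3
    have h4 : ENNReal.ofReal ((1 - (1 - a') / 2) * A α / D + -1) ≤ u α := by
      rw [← sub_eq_add_neg, ENNReal.ofReal_sub _ zero_le_one, ENNReal.ofReal_one]
      exact tsub_le_iff_right.2 (hA₀ α h2)
    rw [← ENNReal.ofReal_toReal hatop]
    refine lt_of_lt_of_le ((ENNReal.ofReal_lt_ofReal_iff (ha0.trans_lt h1)).2 h1) ?_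
    rw [ENNReal.ofReal_div_of_pos h3]
    exact ENNReal.div_le_div_right h4 _
  · obtain ⟨c, hc1, hca⟩ := ENNReal.lt_iff_exists_nnreal_btwn.1 ha
    have hc1' : (1 : ℝ) < c := by exact_mod_cast hc1
    obtain ⟨K, hK⟩ := hup ((c - 1) / 2) (by linarith)
    have hlim := (hA.tendsto_affine hD (1 + ((c : ℝ) - 1) / 2) K).eventually
      (gt_mem_nhds (show 1 + ((c : ℝ) - 1) / 2 < c by linarith))
    filter_upwards [hlim, hA.tendsto_atTop.eventually_gt_atTop 0, eventually_abs_log_div_pos hD]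
      with α h1 h2 h3
    refine lt_of_le_of_lt ?_ hca
    refine (ENNReal.div_le_div_right (hK α h2) _).trans ?_
    rw [← ENNReal.ofReal_div_of_pos h3, ← ENNReal.ofReal_coe_nnreal]
    exact ENNReal.ofReal_le_ofReal h1.le

lemma AsympEq.div_right {u u' : ℝ → ℝ≥0∞} {D : ℝ} (hD : 0 < D)
    (hu : AsympEq u fun α => ENNReal.ofReal (|Real.log α| / D))
    (hu' : AsympEq u' fun α => ENNReal.ofReal (|Real.log α| / D)) : AsympEq u u' := by
  have h := ENNReal.Tendsto.div hu (Or.inl one_ne_zero) hu' (Or.inl ENNReal.one_ne_top)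
  rw [ENNReal.div_self one_ne_zero ENNReal.one_ne_top] at h
  refine h.congr' ?_
  filter_upwards [eventually_abs_log_div_pos hD] with α hα
  rw [ENNReal.div_eq_inv_mul, ENNReal.div_eq_inv_mul (a := u' α), ← ENNReal.div_eq_inv_mul,
    ENNReal.div_eq_inv_mul (b := ENNReal.ofReal (|Real.log α| / D)), ENNReal.mul_div_mul_left]
  · exact ENNReal.inv_ne_zero.2 ENNReal.ofReal_ne_top
  · exact ENNReal.inv_ne_top.2 (ENNReal.ofReal_pos.2 hα).ne'

namespace IsExpFamily

variable {ν : Measure ℝ} {f₀ : ℝ → ℝ} {f : ℝ → ℝ → ℝ} {b : ℝ → ℝ} {Θ : Set ℝ} {θ θ' : ℝ}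

/-- Under `f θ` the log-likelihood ratio of `f θ'` has a negative exponential moment: tilting by
`-θ` undoes the exponential factor of `f θ`. -/
lemma integrable_exp_neg_llr (hE : IsExpFamily ν f₀ f b Θ) (hθ : θ ∈ Θ) (hθ' : θ' ∈ Θ)
    (h0 : θ' ≠ 0) :
    Integrable (fun x => Real.exp (-(θ / θ' * llr f₀ (f θ') x))) (obsLaw ν (f θ)) := by
  have := isProbabilityMeasure_obsLaw hE.pdf₀
  have h1 : Integrable (fun x => Real.exp (θ / θ' * b θ' - θ * x)) (obsLaw ν (f θ)) := by
    refine integrable_exp_of_lintegral (by fun_prop) ?_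
    rw [hE.lintegral_obsLaw hθ (by fun_prop)]
    have : ∀ x, ENNReal.ofReal (Real.exp (θ * x - b θ)) *
        ENNReal.ofReal (Real.exp (θ / θ' * b θ' - θ * x))
        = ENNReal.ofReal (Real.exp (θ / θ' * b θ' - b θ)) := by
      intro x
      rw [← ENNReal.ofReal_mul (Real.exp_pos _).le, ← Real.exp_add]
      congr 2
      ring
    simp only [this, lintegral_const, measure_univ, mul_one]
    exact ENNReal.ofReal_ne_top
  refine h1.congr ?_
  filter_upwards [hE.ae_ne_zero hθ] with x hx
  rw [hE.llr_eq hθ' hx]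
  congr 1
  field_simp
  ring

/-- First order lower bound for the worst case delay: skipping observations does not speed up the
detection. -/
lemma exists_le_wadd_add_one (hE : IsExpFamily ν f₀ f b Θ) {θu : ℝ} (hΘ0 : ∀ θ ∈ Θ, 0 < θ)
    (hΘu : ∀ θ ∈ Θ, θ ≤ θu) (hθ : θ ∈ Θ)
    (hi : Integrable (llr f₀ (f θ)) (obsLaw ν (f θ))) (hD : 0 < divPost ν f₀ (f θ)) {ε : ℝ}
    (hε : 0 < ε) (hε1 : ε < 1) :
    ∃ A₀ : ℝ, ∀ A, A₀ ≤ A → ∀ (C : Control) (Ψ : Policy),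
      (∀ x, Ψ.τ x = firstPassage (glrStat f₀ f Θ (C.used x) x) A) →
      ENNReal.ofReal ((1 - ε) * A / divPost ν f₀ (f θ)) ≤ WADD ν f₀ (f θ) Ψ + 1 := by
  have := isProbabilityMeasure_obsLaw (hE.pdf θ hθ)
  obtain ⟨A₀, hA₀⟩ := hE.lintegral_firstPassage_ge hΘ0 hΘu hθ hi hD hε hε1
  refine ⟨max A₀ 1, fun A hA C Ψ hτ => ?_⟩
  have hA1 : 0 < A := one_pos.trans_le ((le_max_right _ _).trans hA)
  refine (hA₀ A ((le_max_left _ _).trans hA)).trans ?_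
  refine (C.lintegral_firstPassage_le hA1 (map_tail_lawChange_one hE.pdf₀ (hE.pdf θ hθ))
    ((hE.measurable_firstPassage A).comp
      (measurable_cons_comp measurable_const measurable_id))).trans ?_
  simp only [← hτ]
  exact lintegral_tau_le_wadd_add_one hE.pdf₀ (hE.pdf θ hθ) Ψ

lemma wadd_asympEq (hE : IsExpFamily ν f₀ f b Θ) {θu : ℝ} (hΘ0 : ∀ θ ∈ Θ, 0 < θ)
    (hΘu : ∀ θ ∈ Θ, θ ≤ θu) (hθ : θ ∈ Θ)
    (hi : Integrable (llr f₀ (f θ)) (obsLaw ν (f θ))) (hD : 0 < divPost ν f₀ (f θ))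
    {A : ℝ → ℝ} (hA : IsThreshold A) (C : Control) {Ψ : ℝ → Policy}
    (hS : ∀ α k x, 1 ≤ k → (Ψ α).S k x = C.used x k)
    (hτ : ∀ α x, (Ψ α).τ x = firstPassage (glrStat f₀ f Θ (C.used x) x) (A α))
    {V : ℝ → ℝ} {B : ℝ} (hV0 : ∀ w, 0 ≤ V w)
    (hVi : ∀ w, 0 ≤ w → Integrable (fun x => V (C.adv w x)) (obsLaw ν (f θ)))
    (hVadv : ∀ w, 0 ≤ w → ∫ x, V (C.adv w x) ∂(obsLaw ν (f θ)) ≤ V w)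
    (hVskip : ∀ w, w < 0 → 1 + V (C.skip w) ≤ V w)
    (hVB : ∀ n x, V (C.state n 0 x) ≤ B) :
    AsympEq (fun α => WADD ν f₀ (f θ) (Ψ α))
      fun α => ENNReal.ofReal (|Real.log α| / divPost ν f₀ (f θ)) := by
  refine asympEq_of_bounds hA hD (fun ε hε hε1 => ?_) fun ε hε => ?_
  · obtain ⟨A₀, hA₀⟩ := hE.exists_le_wadd_add_one hΘ0 hΘu hθ hi hD hε hε1
    exact ⟨A₀, fun α hα => hA₀ _ hα C (Ψ α) (hτ α)⟩
  · obtain ⟨K, hK⟩ := C.exists_wadd_le hE.pdf₀ hθ (hE.pdf θ hθ) hi hD hV0 hVi hVadv hVskip hVB hε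
    exact ⟨K, fun α hα => hK _ hα (Ψ α) (hS α) (hτ α)⟩

lemma far_gdecusum_le (hE : IsExpFamily ν f₀ f b Θ) (hθ : θ ∈ Θ) (μ : ℝ) (h : ℝ≥0∞) {A : ℝ}
    (hA : 0 < A) :
    FAR ν f₀ (gdecusum f₀ f Θ θ μ h A) ≤ FAR ν f₀ (gcusum f₀ f Θ A) := by
  have := isProbabilityMeasure_obsLaw hE.pdf₀
  refine ENNReal.inv_le_inv.2 ?_
  have hm := (hE.measurable_firstPassage A).comp
    (measurable_cons_comp (f := fun _ : ℕ → ℝ => (0 : ℝ)) measurable_const measurable_id)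
  have h1 := (decusumControl (measurable_llr hE.pdf₀ (hE.pdf θ hθ)) μ h).lintegral_firstPassage_le
    hA (map_tail_iid (obsLaw ν f₀)) hm
  simp only [gdecusum_tau_eq (measurable_llr hE.pdf₀ (hE.pdf θ hθ))]
  refine le_trans (le_of_eq ?_) h1
  have h2 : ∀ x : ℕ → ℝ, (gcusum f₀ f Θ A).τ x
      = firstPassage (glrStat f₀ f Θ (fun _ => 1) (cons 0 (tail x))) A := by
    intro x
    refine firstPassage_congr fun n _ => glrStat_congr (fun _ _ => rfl) fun i hi => ?_
    obtain ⟨i, rfl⟩ : ∃ i', i = i' + 1 := ⟨i - 1, by omega⟩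
    rfl
  simp only [h2]
  conv_rhs => rw [← map_tail_iid (obsLaw ν f₀)]
  exact (lintegral_map (f := fun y =>
    (firstPassage (glrStat f₀ f Θ (fun _ => 1) (cons 0 y)) A : ℝ≥0∞))
    (measurable_from_top.comp hm) measurable_tail).symm

/-- The thresholds `log (1/α) + √(log (1/α))`: the second term absorbs the factor `1 + A` in the
bound `K (1 + A) e^{-A}` for the false alarm rate. -/
lemma exists_threshold (hE : IsExpFamily ν f₀ f b Θ) {θl θu : ℝ} (hθl : 0 < θl)
    (hlΘ : θl ∈ Θ) (hΘ : Θ ⊆ Set.Icc θl θu) (hpre : 0 < divPre ν f₀ (f θl)) :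
    ∃ A : ℝ → ℝ, IsThreshold A ∧
      ∀ᶠ α in 𝓝[>] (0 : ℝ), FAR ν f₀ (gcusum f₀ f Θ (A α)) ≤ ENNReal.ofReal α := by
  obtain ⟨K, hK0, hK⟩ := hE.far_gcusum_le hθl hlΘ hΘ hpre
  have hs : Tendsto (fun α : ℝ => √(Real.log (1 / α))) (𝓝[>] 0) atTop :=
    Real.tendsto_sqrt_atTop.comp tendsto_log_one_div
  refine ⟨fun α => Real.log (1 / α) + √(Real.log (1 / α)), ?_, ?_⟩
  · have h1 : Tendsto (fun α : ℝ => 1 + 1 / √(Real.log (1 / α))) (𝓝[>] 0) (𝓝 (1 + 0)) :=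
      tendsto_const_nhds.add (hs.const_div_atTop 1)
    rw [add_zero] at h1
    refine h1.congr' ?_
    filter_upwards [tendsto_log_one_div.eventually_gt_atTop 0] with α hα
    rw [add_div, div_self hα.ne', Real.sqrt_div_self', one_div]
  · have hlim : Tendsto (fun s : ℝ => K * (s ^ 0 * Real.exp (-s) + s ^ 2 * Real.exp (-s)
        + s ^ 1 * Real.exp (-s))) atTop (𝓝 (K * (0 + 0 + 0))) :=
      (((Real.tendsto_pow_mul_exp_neg_atTop_nhds_zero 0).add
        (Real.tendsto_pow_mul_exp_neg_atTop_nhds_zero 2)).add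
        (Real.tendsto_pow_mul_exp_neg_atTop_nhds_zero 1)).const_mul K
    have hlt : K * (0 + 0 + 0) < 1 := by norm_num
    filter_upwards [(hlim.comp hs).eventually (gt_mem_nhds hlt), self_mem_nhdsWithin,
      tendsto_log_one_div.eventually_ge_atTop 1] with α h1 h2 h3
    have hα : 0 < α := h2
    set l := Real.log (1 / α) with hl
    have hs0 : 0 ≤ √l := Real.sqrt_nonneg l
    have hsq : √l ^ 2 = l := Real.sq_sqrt (by linarith)
    have hexp : Real.exp (-l) = α := by
      rw [hl, one_div, Real.log_inv, neg_neg, Real.exp_log hα]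
    refine (hK _ (by linarith)).trans (ENNReal.ofReal_le_ofReal ?_)
    have e : K * (1 + (l + √l)) * Real.exp (-(l + √l))
        = K * (√l ^ 0 * Real.exp (-√l) + √l ^ 2 * Real.exp (-√l)
          + √l ^ 1 * Real.exp (-√l)) * α := by
      rw [neg_add, Real.exp_add, hexp, hsq]
      ring
    rw [e]
    simp only [Function.comp_apply, ← hl] at h1
    nlinarith

end IsExpFamily

end QCD

theorem corollary3
    (ν : Measure ℝ) [SigmaFinite ν]
    (f₀ : ℝ → ℝ) (f : ℝ → ℝ → ℝ) (b : ℝ → ℝ) (θl θu θs : ℝ)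
    (hθl : 0 < θl) (hθlu : θl < θu)
    (hf₀ : QCD.IsPDF ν f₀)
    (hf : ∀ θ ∈ Set.Icc θl θu, QCD.IsPDF ν (f θ))
    (hexp : ∀ θ ∈ Set.Icc θl θu, ∀ x, f θ x = Real.exp (θ * x - b θ) * f₀ x)
    (hb : b 0 = 0)
    (hdiv : ∀ θ ∈ Set.Icc θl θu, QCD.FinitePosDivergences ν f₀ (f θ))
    (hlf : QCD.IsLeastFavorable ν f₀ f (Set.Icc θl θu) θs) :
    (∃ A : ℝ → ℝ, QCD.IsThreshold A ∧
      ∃ ε : ℝ → ℝ, Tendsto ε (𝓝[>] 0) (𝓝 0) ∧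
        ∀ᶠ α in 𝓝[>] (0 : ℝ),
          QCD.FAR ν f₀ (QCD.gcusum f₀ f (Set.Icc θl θu) (A α))
            ≤ ENNReal.ofReal (α * (1 + ε α))) ∧
    (∀ A : ℝ → ℝ, QCD.IsThreshold A → ∀ μ : ℝ, 0 < μ → ∀ h : ℝ≥0∞,
      (∀ α : ℝ, 0 < A α →
        QCD.FAR ν f₀ (QCD.gdecusum f₀ f (Set.Icc θl θu) θs μ h (A α))
          ≤ QCD.FAR ν f₀ (QCD.gcusum f₀ f (Set.Icc θl θu) (A α))) ∧
      (∀ α : ℝ,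
        QCD.PDC ν f₀ (QCD.gdecusum f₀ f (Set.Icc θl θu) θs μ h (A α))
          = QCD.PDC ν f₀ (QCD.decusum f₀ (f θs) μ h (A α))) ∧
      (h < ∞ → ∀ θ ∈ Set.Icc θl θu,
        QCD.AsympEq
          (fun α => QCD.WADD ν f₀ (f θ) (QCD.gdecusum f₀ f (Set.Icc θl θu) θs μ h (A α)))
          (fun α => QCD.WADD ν f₀ (f θ) (QCD.gcusum f₀ f (Set.Icc θl θu) (A α))) ∧
        QCD.AsympEq
          (fun α => QCD.WADD ν f₀ (f θ) (QCD.gcusum f₀ f (Set.Icc θl θu) (A α)))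
          (fun α => ENNReal.ofReal (|Real.log α| / QCD.divPost ν f₀ (f θ))) ∧
        QCD.AsympEq
          (fun α => QCD.WADD ν f₀ (f θ) (QCD.gdecusum f₀ f (Set.Icc θl θu) θs μ h (A α)))
          (fun α => ENNReal.ofReal (|Real.log α| / QCD.divPost ν f₀ (f θ))))) := by
  have hE : QCD.IsExpFamily ν f₀ f b (Set.Icc θl θu) := ⟨hf₀, hf, hexp⟩
  have hlΘ : θl ∈ Set.Icc θl θu := ⟨le_rfl, hθlu.le⟩
  have hΘ0 : ∀ θ ∈ Set.Icc θl θu, 0 < θ := fun θ hθ => hθl.trans_le hθ.1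
  have hΘu : ∀ θ ∈ Set.Icc θl θu, θ ≤ θu := fun θ hθ => hθ.2
  obtain ⟨hθs, hpos⟩ := hlf
  constructor
  · obtain ⟨A, hA, hle⟩ := hE.exists_threshold hθl hlΘ subset_rfl (hdiv θl hlΘ).2.2.2
    exact ⟨A, hA, fun _ => 0, tendsto_const_nhds, by simpa using hle⟩
  intro A hA μ hμ h
  refine ⟨fun α hα => hE.far_gdecusum_le hθs μ h hα,
    fun α => QCD.pdc_gdecusum ν f₀ f _ θs μ h (A α), fun hh θ hθ => ?_⟩
  obtain ⟨hi, hD, -, -⟩ := hdiv θ hθ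
  have := QCD.isProbabilityMeasure_obsLaw (hf θ hθ)
  have hGC : QCD.AsympEq
      (fun α => QCD.WADD ν f₀ (f θ) (QCD.gcusum f₀ f (Set.Icc θl θu) (A α)))
      (fun α => ENNReal.ofReal (|Real.log α| / QCD.divPost ν f₀ (f θ))) := by
    -- no observation is skipped: the state stays at `0`, and the potential is needed only below `0`
    refine hE.wadd_asympEq hΘ0 hΘu hθ hi hD hA QCD.alwaysUse
      (fun α k x _ => by rw [QCD.used_alwaysUse]; rfl)
      (fun α x => QCD.gcusum_tau_eq f₀ f _ (A α) x)
      (V := fun w => if 0 ≤ w then 0 else 1) (B := 0) (fun w => by positivity) ?_ ?_ ?_ ?_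
    · intro w _
      simp [QCD.alwaysUse]
    · intro w hw
      simp [QCD.alwaysUse, hw]
    · intro w hw
      simp [QCD.alwaysUse, not_le.2 hw]
    · intro n x
      simp [QCD.state_alwaysUse]
  have hGD : QCD.AsympEq
      (fun α => QCD.WADD ν f₀ (f θ) (QCD.gdecusum f₀ f (Set.Icc θl θu) θs μ h (A α)))
      (fun α => ENNReal.ofReal (|Real.log α| / QCD.divPost ν f₀ (f θ))) := by
    have hLm := QCD.measurable_llr hf₀ (hf θs hθs)
    have hLi : Integrable (QCD.llr f₀ (f θs)) (QCD.obsLaw ν (f θ)) := by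
      by_contra hn
      have := hpos θ hθ
      rw [integral_undef hn] at this
      exact lt_irrefl _ this
    obtain ⟨t, ht, hti, ht1⟩ := QCD.exists_integral_exp_neg_lt_one hLm hLi (hpos θ hθ)
      (div_pos (hΘ0 θ hθ) (hΘ0 θs hθs)) (hE.integrable_exp_neg_llr hθ hθs (hΘ0 θs hθs).ne')
    obtain ⟨V, B, hV0, hVi, hVadv, hVskip, hVB⟩ := QCD.exists_potential hLm ht hti ht1 hμ hh
    exact hE.wadd_asympEq hΘ0 hΘu hθ hi hD hA (QCD.decusumControl hLm μ h)
      (fun α k x hk => QCD.gdControl_eq_used hLm μ h x hk)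
      (fun α x => QCD.gdecusum_tau_eq hLm _ μ h (A α) x) hV0 hVi hVadv hVskip hVB
  exact ⟨hGD.div_right hD hGC, hGC, hGD⟩
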